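/- Fix $\Lambda>0$ and put $\Omega_L=(-\infty,-\Lambda)$, $\Omega_R=(\Lambda,\infty)$, $\Omega_\Lambda=\Omega_L\cup\Omega_R$. For $\Omega$ one of these sets let $AC^2(\overline\Omega)$ be the set of functions $\psi$ on $\overline\Omega$ that are differentiable (one-sidedly at the boundary points), such that $\psi$ and $\psi'$ are absolutely continuous on every compact interval contained in $\overline\Omega$ and $\psi''\in L^2(\Omega)$. Let $H_0$ be the closure in $L^2(\Omega_\Lambda)$ of $-d^2/dx^2$ with domain $C_0^\infty(\Omega_\Lambda)$; its adjoint $H_0^*$ is $-d^2/dx^2$ with domain $D(H_0^*)=L^2(\Omega_\Lambda)\cap AC^2(\overline{\Omega_\Lambda})$. With $N=\sqrt[4]{2}\,e^{\Lambda/\sqrt2}$ let $$L_\pm(x)=N e^{(1\mp i)x/\sqrt2}\ (x<-\Lambda),\quad L_\pm(x)=0\ (x>\Lambda),\qquad R_\pm(x)=0\ (x<-\Lambda),\quad R_\pm(x)=N e^{(-1\pm i)x/\sqrt2}\ (x>\Lambda).$$ (i) Let $\theta_L,\theta_R\in[0,2\pi)$, $\gamma_L=e^{i(\theta_L+\sqrt2\Lambda)}$,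 $\gamma_R=e^{i(\theta_R+\sqrt2\Lambda)}$, $\gamma=(\gamma_L,\gamma_R)$. The operator $H_\gamma=-d^2/dx^2$ with domain $$D(H_\gamma)=\{\psi_0+c_L(L_++\gamma_LL_-)+c_R(R_++\gamma_RR_-)\;:\;\psi_0\in D(H_0),\ c_L,c_R\in\mathbb C\}$$ is well defined (that is, $D(H_\gamma)\subset D(H_0^*)$) and is a self-adjoint extension of $H_0$. (ii) Let $\alpha=(\alpha_L,\alpha_R)\in(\mathbb R\cup\{\infty\})^2$. The operator $H_\alpha=-d^2/dx^2$, whose domain consists of all $\psi\in D(H_0^*)$ with $$\psi'(-\Lambda)=\alpha_L\psi(-\Lambda)\quad\text{and}\quad\psi'(\Lambda)=\alpha_R\psi(\Lambda),$$ where for $\alpha_L=\infty$ the first condition is read as $\psi(-\Lambda)=0$ and for $\alpha_R=\infty$ the second one as $\psi(\Lambda)=0$, is a self-adjoint extension of $H_0$. (The Neumann condition $\psi'=0$ is the case $\alpha_\sharp=0$.) (iii) For $\theta_L,\theta_R\in[0,2\pi)$, with $\gamma$ as in (i), and $\alpha\in(\mathbb R\cup\{\infty\})^2$, one has $H_\alpha=H_\gamma$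 if and only if $$\alpha_L=\frac{1+\cos\theta_L-\sin\theta_L}{\sqrt2(1+\cos\theta_L)}\quad\text{and}\quad \alpha_R=-\frac{1+\cos\theta_R-\sin\theta_R}{\sqrt2(1+\cos\theta_R)},$$ where the right-hand side is read as $\infty$ if the angle equals $\pi$. This correspondence is a bijection between the $(\theta_L,\theta_R)\in[0,2\pi)^2$ and the $\alpha\in(\mathbb R\cup\{\infty\})^2$. Moreover, for every $\alpha\in(\mathbb R\cup\{\infty\})^2$, $H_\alpha\cong H_{\alpha_L}\oplus H_{\alpha_R}$: the unitary map $\psi\mapsto(\psi|_{\Omega_L},\psi|_{\Omega_R})$ from $L^2(\Omega_\Lambda)$ onto $L^2(\Omega_L)\oplus L^2(\Omega_R)$ carries $H_\alpha$ to $H_{\alpha_L}\oplus H_{\alpha_R}$. Here $H_{\alpha_L}$ is $-d^2/dx^2$ in $L^2(\Omega_L)$ on the $\psi\in L^2(\Omega_L)\cap AC^2(\overline{\Omega_L})$ satisfying the boundary condition at $-\Lambda$ with parameter $\alpha_L$, and $H_{\alpha_R}$ is $-d^2/dx^2$ in $L^2(\Omega_R)$ on the $\psi\in L^2(\Omega_R)\cap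 AC^2(\overline{\Omega_R})$ satisfying the boundary condition at $\Lambda$ with parameter $\alpha_R$. -/

import Mathlib

open MeasureTheory Set
open scoped ContDiff LinearPMap

noncomputable section

namespace Junction

/-- The Hilbert space `L²(Ω)` of an open subset `Ω` of the line. -/
abbrev L2 (Ω : TopologicalSpace.Opens ℝ) : Type :=
  Lp ℂ 2 (volume.restrict (Ω : Set ℝ))

/-- The island `Ω_L = (-∞, -Λ)`. -/
def leftIsland (Λ : ℝ) : TopologicalSpace.Opens ℝ := ⟨Iio (-Λ), isOpen_Iio⟩

/-- The island `Ω_R = (Λ, ∞)`. -/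
def rightIsland (Λ : ℝ) : TopologicalSpace.Opens ℝ := ⟨Ioi Λ, isOpen_Ioi⟩

/-- The line with the junction `[-Λ, Λ]` removed, `Ω_Λ = (-∞, -Λ) ∪ (Λ, ∞)`. -/
def islands (Λ : ℝ) : TopologicalSpace.Opens ℝ :=
  ⟨Iio (-Λ) ∪ Ioi Λ, isOpen_Iio.union isOpen_Ioi⟩

/-! ### The class `AC²` and the operator `-d²/dx²` on it -/

/-- The first derivative on the closure of `Ω`; it is one-sided at the boundary points of `Ω`. -/
def d1 (Ω : TopologicalSpace.Opens ℝ) (ψ : ℝ → ℂ) : ℝ → ℂ :=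
  derivWithin ψ (closure (Ω : Set ℝ))

/-- The second derivative on the closure of `Ω`. -/
def d2 (Ω : TopologicalSpace.Opens ℝ) (ψ : ℝ → ℂ) : ℝ → ℂ :=
  d1 Ω (d1 Ω ψ)

/-- `ψ` is of class `AC²` on the closure of `Ω`: it is differentiable there, `ψ` and its
derivative are absolutely continuous on every compact interval contained in the closure,
and the second derivative is square integrable on `Ω`. The values of `ψ` off the closure of
`Ω` are irrelevant. -/
structure IsAC2 (Ω : TopologicalSpace.Opens ℝ) (ψ : ℝ → ℂ) : Prop where
  ac : ∀ a b : ℝ, uIcc a b ⊆ closure (Ω : Set ℝ) → AbsolutelyContinuousOnInterval ψ a b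
  diff : DifferentiableOn ℝ ψ (closure (Ω : Set ℝ))
  ac_d1 : ∀ a b : ℝ, uIcc a b ⊆ closure (Ω : Set ℝ) →
    AbsolutelyContinuousOnInterval (d1 Ω ψ) a b
  memLp_d2 : MemLp (d2 Ω ψ) 2 (volume.restrict (Ω : Set ℝ))

variable {Ω : TopologicalSpace.Opens ℝ}

lemma d1_congr {ψ φ : ℝ → ℂ} (h : EqOn ψ φ (Ω : Set ℝ)) :
    EqOn (d1 Ω ψ) (d1 Ω φ) (Ω : Set ℝ) := by
  intro x hx
  have hn : closure (Ω : Set ℝ) ∈ nhds x :=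
    Filter.mem_of_superset (Ω.isOpen.mem_nhds hx) subset_closure
  simp only [d1, derivWithin_of_mem_nhds hn]
  exact Filter.EventuallyEq.deriv_eq (Filter.mem_of_superset (Ω.isOpen.mem_nhds hx) h)

lemma d2_congr {ψ φ : ℝ → ℂ} (h : EqOn ψ φ (Ω : Set ℝ)) :
    EqOn (d2 Ω ψ) (d2 Ω φ) (Ω : Set ℝ) := d1_congr (d1_congr h)

lemma IsAC2.d2_ae_unique {ψ φ : ℝ → ℂ} (hψ : IsAC2 Ω ψ) (hφ : IsAC2 Ω φ)
    (h : ψ =ᵐ[volume.restrict (Ω : Set ℝ)] φ) :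
    d2 Ω ψ =ᵐ[volume.restrict (Ω : Set ℝ)] d2 Ω φ := by
  have h1 : EqOn ψ φ (Ω : Set ℝ) := Measure.eqOn_open_of_ae_eq h Ω.isOpen
    (hψ.diff.continuousOn.mono subset_closure) (hφ.diff.continuousOn.mono subset_closure)
  exact (ae_restrict_mem Ω.isOpen.measurableSet).mono fun x hx => d2_congr h1 hx

lemma IsAC2.ae_differentiable_d1 {ψ : ℝ → ℂ} (hψ : IsAC2 Ω ψ) :
    ∀ᵐ x ∂volume.restrict (Ω : Set ℝ),
      DifferentiableWithinAt ℝ (d1 Ω ψ) (closure (Ω : Set ℝ)) x := by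
  rw [ae_restrict_iff' Ω.isOpen.measurableSet, ae_iff]
  refine measure_null_of_locally_null _ fun x hx => ?_
  simp only [mem_ofPred_eq, Classical.not_imp] at hx
  obtain ⟨ε, hε, hball⟩ := Metric.isOpen_iff.1 Ω.isOpen x hx.1
  have hsub : uIcc (x - ε / 2) (x + ε / 2) ⊆ (Ω : Set ℝ) := by
    intro y hy
    apply hball
    rw [uIcc_of_le (by linarith)] at hy
    rw [Metric.mem_ball, Real.dist_eq, abs_lt]
    constructor <;> linarith [hy.1, hy.2]
  have hbv := (hψ.ac_d1 _ _ (hsub.trans subset_closure)).boundedVariationOn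
  have hae := hbv.ae_differentiableAt_of_mem_uIcc
  rw [ae_iff] at hae
  refine ⟨_, inter_mem_nhdsWithin _ (Icc_mem_nhds (a := x - ε / 2) (b := x + ε / 2)
    (by linarith) (by linarith)), measure_mono_null ?_ hae⟩
  rintro y ⟨hy, hy'⟩
  simp only [mem_ofPred_eq, Classical.not_imp] at hy ⊢
  refine ⟨by rwa [uIcc_of_le (by linarith)], fun hd => hy.2 hd.differentiableWithinAt⟩

lemma IsAC2.eqOn_d1_add {ψ φ : ℝ → ℂ} (hψ : IsAC2 Ω ψ) (hφ : IsAC2 Ω φ) :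
    EqOn (d1 Ω (ψ + φ)) (d1 Ω ψ + d1 Ω φ) (closure (Ω : Set ℝ)) := fun x hx =>
  derivWithin_add (hψ.diff x hx) (hφ.diff x hx)

lemma IsAC2.eqOn_d1_smul {ψ : ℝ → ℂ} (c : ℂ) (hψ : IsAC2 Ω ψ) :
    EqOn (d1 Ω (c • ψ)) (c • d1 Ω ψ) (closure (Ω : Set ℝ)) := fun x hx =>
  derivWithin_const_smul c (hψ.diff x hx)

lemma ac_congr {f g : ℝ → ℂ} {a b : ℝ} (h : EqOn f g (uIcc a b))
    (hg : AbsolutelyContinuousOnInterval g a b) : AbsolutelyContinuousOnInterval f a b := by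
  rw [absolutelyContinuousOnInterval_iff] at hg ⊢
  intro ε hε
  obtain ⟨δ, hδ, H⟩ := hg ε hε
  refine ⟨δ, hδ, fun E hE hlen => ?_⟩
  have := H E hE hlen
  rwa [Finset.sum_congr rfl fun i hi => by rw [h (hE.1 i hi).1, h (hE.1 i hi).2]]

lemma IsAC2.d2_add {ψ φ : ℝ → ℂ} (hψ : IsAC2 Ω ψ) (hφ : IsAC2 Ω φ) :
    d2 Ω (ψ + φ) =ᵐ[volume.restrict (Ω : Set ℝ)] d2 Ω ψ + d2 Ω φ := by
  filter_upwards [hψ.ae_differentiable_d1, hφ.ae_differentiable_d1,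
    ae_restrict_mem Ω.isOpen.measurableSet] with x h1 h2 hx
  have h3 : d2 Ω (ψ + φ) x = d1 Ω (d1 Ω ψ + d1 Ω φ) x :=
    derivWithin_congr (hψ.eqOn_d1_add hφ) (hψ.eqOn_d1_add hφ (subset_closure hx))
  rw [h3]
  exact derivWithin_add h1 h2

lemma IsAC2.d2_smul {ψ : ℝ → ℂ} (c : ℂ) (hψ : IsAC2 Ω ψ) :
    d2 Ω (c • ψ) =ᵐ[volume.restrict (Ω : Set ℝ)] c • d2 Ω ψ := by
  filter_upwards [hψ.ae_differentiable_d1, ae_restrict_mem Ω.isOpen.measurableSet] with x h1 hx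
  have h3 : d2 Ω (c • ψ) x = d1 Ω (c • d1 Ω ψ) x :=
    derivWithin_congr (hψ.eqOn_d1_smul c) (hψ.eqOn_d1_smul c (subset_closure hx))
  rw [h3]
  exact derivWithin_const_smul c h1

lemma IsAC2.add {ψ φ : ℝ → ℂ} (hψ : IsAC2 Ω ψ) (hφ : IsAC2 Ω φ) : IsAC2 Ω (ψ + φ) where
  ac a b h := (hψ.ac a b h).add (hφ.ac a b h)
  diff := hψ.diff.add hφ.diff
  ac_d1 a b h := ac_congr ((hψ.eqOn_d1_add hφ).mono h) ((hψ.ac_d1 a b h).add (hφ.ac_d1 a b h))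
  memLp_d2 := (memLp_congr_ae (hψ.d2_add hφ)).2 (hψ.memLp_d2.add hφ.memLp_d2)

lemma IsAC2.smul {ψ : ℝ → ℂ} (c : ℂ) (hψ : IsAC2 Ω ψ) : IsAC2 Ω (c • ψ) where
  ac a b h := (hψ.ac a b h).const_smul c
  diff := hψ.diff.const_smul c
  ac_d1 a b h := ac_congr ((hψ.eqOn_d1_smul c).mono h) ((hψ.ac_d1 a b h).const_smul c)
  memLp_d2 := (memLp_congr_ae (hψ.d2_smul c)).2 (hψ.memLp_d2.const_smul c)

lemma isAC2_of_contDiff {ψ : ℝ → ℂ} (hψ : ContDiff ℝ ∞ ψ) (hc : HasCompactSupport ψ)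
    (hs : tsupport ψ ⊆ (Ω : Set ℝ)) : IsAC2 Ω ψ := by
  have key : ∀ χ : ℝ → ℂ, ContDiff ℝ ∞ χ → tsupport χ ⊆ (Ω : Set ℝ) → d1 Ω χ = deriv χ := by
    intro χ hχ hsχ
    funext x
    by_cases hx : x ∈ (Ω : Set ℝ)
    · exact derivWithin_of_mem_nhds
        (Filter.mem_of_superset (Ω.isOpen.mem_nhds hx) subset_closure)
    · have h0 : χ =ᶠ[nhds x] fun _ => 0 := notMem_tsupport_iff_eventuallyEq.1 fun h => hx (hsχ h)
      rw [h0.deriv_eq, d1, (h0.filter_mono nhdsWithin_le_nhds).derivWithin_eq h0.eq_of_nhds]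
      simp
  have h1 : ContDiff ℝ ∞ (deriv ψ) := ContDiff.deriv' hψ
  have h2 : ContDiff ℝ ∞ (deriv (deriv ψ)) := ContDiff.deriv' h1
  have e1 : d1 Ω ψ = deriv ψ := key ψ hψ hs
  have e2 : d2 Ω ψ = deriv (deriv ψ) := by
    rw [d2, e1]
    exact key _ h1 (tsupport_deriv_subset.trans hs)
  refine ⟨fun a b _ => ?_, (hψ.differentiable (by simp)).differentiableOn, fun a b _ => ?_, ?_⟩
  · exact (hψ.of_le (by simp)).contDiffOn.absolutelyContinuousOnInterval
  · rw [e1]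
    exact (h1.of_le (by simp)).contDiffOn.absolutelyContinuousOnInterval
  · rw [e2]
    exact (h2.continuous.memLp_of_hasCompactSupport hc.deriv.deriv).restrict _

lemma isAC2_zero : IsAC2 Ω (0 : ℝ → ℂ) :=
  isAC2_of_contDiff contDiff_const HasCompactSupport.zero (by simp [tsupport])

/-- The elements of `L²(Ω)` that have a representative of class `AC²` on the closure of `Ω`. -/
def ac2Domain (Ω : TopologicalSpace.Opens ℝ) : Submodule ℂ (L2 Ω) where
  carrier := {f | ∃ ψ : ℝ → ℂ, IsAC2 Ω ψ ∧ f =ᵐ[volume.restrict (Ω : Set ℝ)] ψ}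
  zero_mem' := ⟨0, isAC2_zero, Lp.coeFn_zero _ _ _⟩
  add_mem' := by
    rintro f g ⟨ψ, hψ, hf⟩ ⟨φ, hφ, hg⟩
    exact ⟨ψ + φ, hψ.add hφ, (Lp.coeFn_add f g).trans (hf.add hg)⟩
  smul_mem' := by
    rintro c f ⟨ψ, hψ, hf⟩
    exact ⟨c • ψ, hψ.smul c, (Lp.coeFn_smul c f).trans (hf.const_smul c)⟩

/-- `-ψ''` as an element of `L²(Ω)`, for the `AC²` representative `ψ` of `f`. -/
def negSecondDeriv (f : ac2Domain Ω) : L2 Ω :=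
  -(f.2.choose_spec.1.memLp_d2.toLp (d2 Ω f.2.choose))

lemma negSecondDeriv_ae (f : ac2Domain Ω) {ψ : ℝ → ℂ} (hψ : IsAC2 Ω ψ)
    (h : (f : L2 Ω) =ᵐ[volume.restrict (Ω : Set ℝ)] ψ) :
    negSecondDeriv f =ᵐ[volume.restrict (Ω : Set ℝ)] fun x => -d2 Ω ψ x := by
  have h1 := f.2.choose_spec.1.d2_ae_unique hψ (f.2.choose_spec.2.symm.trans h)
  refine (Lp.coeFn_neg _).trans ?_
  filter_upwards [f.2.choose_spec.1.memLp_d2.coeFn_toLp, h1] with x hx hx'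
  rw [Pi.neg_apply, hx, hx']

/-- The operator `-d²/dx²` in `L²(Ω)` on its maximal domain `AC²`, with no boundary condition. -/
def maxOperator (Ω : TopologicalSpace.Opens ℝ) : L2 Ω →ₗ.[ℂ] L2 Ω where
  domain := ac2Domain Ω
  toFun :=
    { toFun := negSecondDeriv
      map_add' := by
        intro f g
        obtain ⟨ψ, hψ, hf⟩ := f.2
        obtain ⟨φ, hφ, hg⟩ := g.2
        apply Lp.ext
        have h := negSecondDeriv_ae (f + g) (hψ.add hφ)
          ((Lp.coeFn_add (f : L2 Ω) (g : L2 Ω)).trans (hf.add hg))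
        refine h.trans (Filter.EventuallyEq.trans ?_ (Lp.coeFn_add _ _).symm)
        filter_upwards [negSecondDeriv_ae f hψ hf, negSecondDeriv_ae g hφ hg, hψ.d2_add hφ]
          with x h1 h2 h3
        rw [Pi.add_apply, h1, h2, h3, Pi.add_apply]
        ring
      map_smul' := by
        intro c f
        obtain ⟨ψ, hψ, hf⟩ := f.2
        apply Lp.ext
        have h := negSecondDeriv_ae (c • f) (hψ.smul c)
          ((Lp.coeFn_smul c (f : L2 Ω)).trans (hf.const_smul c))
        refine h.trans (Filter.EventuallyEq.trans ?_ (Lp.coeFn_smul _ _).symm)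
        filter_upwards [negSecondDeriv_ae f hψ hf, hψ.d2_smul c] with x h1 h3
        simp only [RingHom.id_apply, Pi.smul_apply] at h3 ⊢
        rw [h1, h3, smul_neg] }

/-! ### The minimal operator -/

/-- `C₀^∞(Ω)`, as a subspace of `L²(Ω)`. -/
def testFunctions (Ω : TopologicalSpace.Opens ℝ) : Submodule ℂ (L2 Ω) where
  carrier := {f | ∃ φ : ℝ → ℂ, ContDiff ℝ ∞ φ ∧ HasCompactSupport φ ∧
    tsupport φ ⊆ (Ω : Set ℝ) ∧ f =ᵐ[volume.restrict (Ω : Set ℝ)] φ}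
  zero_mem' := ⟨0, contDiff_const, HasCompactSupport.zero, by simp [tsupport],
    Lp.coeFn_zero _ _ _⟩
  add_mem' := by
    rintro f g ⟨ψ, h1, h2, h3, hf⟩ ⟨φ, k1, k2, k3, hg⟩
    exact ⟨ψ + φ, h1.add k1, h2.add k2, (tsupport_add ψ φ).trans (union_subset h3 k3),
      (Lp.coeFn_add f g).trans (hf.add hg)⟩
  smul_mem' := by
    rintro c f ⟨ψ, h1, h2, h3, hf⟩
    exact ⟨c • ψ, h1.const_smul c, h2.smul_left (f := fun _ => c),
      (tsupport_smul_subset_right (fun _ => c) ψ).trans h3,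
      (Lp.coeFn_smul c f).trans (hf.const_smul c)⟩

/-- `H₀₀ = -d²/dx²` with domain `C₀^∞(Ω_Λ)`. -/
def H00 (Λ : ℝ) : L2 (islands Λ) →ₗ.[ℂ] L2 (islands Λ) :=
  (maxOperator (islands Λ)).domRestrict (testFunctions (islands Λ))

lemma H00_domain (Λ : ℝ) : (H00 Λ).domain = testFunctions (islands Λ) :=
  inf_eq_left.2 fun _ ⟨φ, h1, h2, h3, hf⟩ => ⟨φ, isAC2_of_contDiff h1 h2 h3, hf⟩

/-- `H₀`, the closure of `H₀₀`. -/
def H0 (Λ : ℝ) : L2 (islands Λ) →ₗ.[ℂ] L2 (islands Λ) := (H00 Λ).closure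

/-- `B` is a self-adjoint extension of `A`. -/
def IsSelfAdjointExtension {E : Type*} [NormedAddCommGroup E] [InnerProductSpace ℂ E]
    [CompleteSpace E] (A B : E →ₗ.[ℂ] E) : Prop :=
  A ≤ B ∧ IsSelfAdjoint B

/-! ### The functions `L_±`, `R_±` and the operator `H_γ` -/

/-- The normalization factor `N = 2^{1/4} e^{Λ/√2}`. -/
def normFactor (Λ : ℝ) : ℂ := (((2 : ℝ) ^ (1 / 4 : ℝ) * Real.exp (Λ / √2) : ℝ) : ℂ)

/-- `L_+`: `N e^{(1-i)x/√2}` on the left island and `0` on the right one. -/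
def LplusFun (Λ : ℝ) : ℝ → ℂ := (Iio (-Λ)).indicator fun x =>
  normFactor Λ * Complex.exp ((1 - Complex.I) * x / (√2 : ℝ))

/-- `L_-`: `N e^{(1+i)x/√2}` on the left island and `0` on the right one. -/
def LminusFun (Λ : ℝ) : ℝ → ℂ := (Iio (-Λ)).indicator fun x =>
  normFactor Λ * Complex.exp ((1 + Complex.I) * x / (√2 : ℝ))

/-- `R_+`: `0` on the left island and `N e^{(-1+i)x/√2}` on the right one. -/
def RplusFun (Λ : ℝ) : ℝ → ℂ := (Ioi Λ).indicator fun x =>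
  normFactor Λ * Complex.exp ((-1 + Complex.I) * x / (√2 : ℝ))

/-- `R_-`: `0` on the left island and `N e^{(-1-i)x/√2}` on the right one. -/
def RminusFun (Λ : ℝ) : ℝ → ℂ := (Ioi Λ).indicator fun x =>
  normFactor Λ * Complex.exp ((-1 - Complex.I) * x / (√2 : ℝ))

lemma norm_cexp_sq (z : ℂ) (x : ℝ) :
    ‖Complex.exp (z * x / (√2 : ℝ))‖ ^ 2 = Real.exp (2 * z.re / √2 * x) := by
  have h : (z * x / (√2 : ℝ)).re = z.re * x / √2 := by
    rw [Complex.div_ofReal_re, Complex.re_mul_ofReal]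
  rw [Complex.norm_exp, h, ← Real.exp_nat_mul]
  congr 1
  push_cast
  ring

lemma memLp_exp_left (c z : ℂ) (a : ℝ) (hz : 0 < z.re) (μ : Measure ℝ) (hμ : μ ≤ volume) :
    MemLp ((Iio a).indicator fun x : ℝ => c * Complex.exp (z * x / (√2 : ℝ))) 2 μ := by
  refine MemLp.mono_measure hμ ?_
  rw [memLp_indicator_iff_restrict measurableSet_Iio]
  refine MemLp.const_mul ?_ c
  rw [memLp_two_iff_integrable_sq_norm (by fun_prop)]
  simp_rw [norm_cexp_sq]
  exact (integrableOn_exp_mul_Iic (a := 2 * z.re / √2) (by positivity) a).mono_set Iio_subset_Iic_self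

lemma memLp_exp_right (c z : ℂ) (a : ℝ) (hz : z.re < 0) (μ : Measure ℝ) (hμ : μ ≤ volume) :
    MemLp ((Ioi a).indicator fun x : ℝ => c * Complex.exp (z * x / (√2 : ℝ))) 2 μ := by
  refine MemLp.mono_measure hμ ?_
  rw [memLp_indicator_iff_restrict measurableSet_Ioi]
  refine MemLp.const_mul ?_ c
  rw [memLp_two_iff_integrable_sq_norm (by fun_prop)]
  simp_rw [norm_cexp_sq]
  exact integrableOn_exp_mul_Ioi
    (div_neg_of_neg_of_pos (by linarith) (Real.sqrt_pos.2 two_pos)) a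

/-- `L_+` as a vector of `L²(Ω_Λ)`. -/
def Lplus (Λ : ℝ) : L2 (islands Λ) :=
  MemLp.toLp (LplusFun Λ) (memLp_exp_left _ _ _ (by simp) _ Measure.restrict_le_self)

/-- `L_-` as a vector of `L²(Ω_Λ)`. -/
def Lminus (Λ : ℝ) : L2 (islands Λ) :=
  MemLp.toLp (LminusFun Λ) (memLp_exp_left _ _ _ (by simp) _ Measure.restrict_le_self)

/-- `R_+` as a vector of `L²(Ω_Λ)`. -/
def Rplus (Λ : ℝ) : L2 (islands Λ) :=
  MemLp.toLp (RplusFun Λ) (memLp_exp_right _ _ _ (by simp) _ Measure.restrict_le_self)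

/-- `R_-` as a vector of `L²(Ω_Λ)`. -/
def Rminus (Λ : ℝ) : L2 (islands Λ) :=
  MemLp.toLp (RminusFun Λ) (memLp_exp_right _ _ _ (by simp) _ Measure.restrict_le_self)

/-- The vectors `ψ₀ + c_L (L_+ + γ_L L_-) + c_R (R_+ + γ_R R_-)` with `ψ₀ ∈ D(H₀)` and
`c_L, c_R ∈ ℂ`. -/
def gammaDomain (Λ : ℝ) (γL γR : ℂ) : Submodule ℂ (L2 (islands Λ)) where
  carrier := {f | ∃ ψ₀ ∈ (H0 Λ).domain, ∃ cL cR : ℂ,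
    f = ψ₀ + cL • (Lplus Λ + γL • Lminus Λ) + cR • (Rplus Λ + γR • Rminus Λ)}
  zero_mem' := ⟨0, zero_mem _, 0, 0, by simp⟩
  add_mem' := by
    rintro f g ⟨f₀, hf, a, b, rfl⟩ ⟨g₀, hg, a', b', rfl⟩
    exact ⟨f₀ + g₀, add_mem hf hg, a + a', b + b', by module⟩
  smul_mem' := by
    rintro c f ⟨f₀, hf, a, b, rfl⟩
    exact ⟨c • f₀, Submodule.smul_mem _ c hf, c * a, c * b, by module⟩

/-- `H_γ = -d²/dx²` on the domain `gammaDomain`. (`domRestrict` intersects this space with the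
maximal domain; that nothing is lost is part of the theorem.) -/
def Hgamma (Λ : ℝ) (γL γR : ℂ) : L2 (islands Λ) →ₗ.[ℂ] L2 (islands Λ) :=
  (maxOperator (islands Λ)).domRestrict (gammaDomain Λ γL γR)

/-- The phase `e^{i(θ + √2 Λ)}`. -/
def phase (Λ θ : ℝ) : ℂ := Complex.exp (Complex.I * ((θ + √2 * Λ : ℝ) : ℂ))

/-! ### Separated boundary conditions and the operators `H_α` -/

/-- The boundary condition with parameter `α ∈ ℝ ∪ {∞}` at the boundary point `p` of `Ω`:
`ψ'(p) = α ψ(p)` for real `α`, and `ψ(p) = 0` for `α = ∞`. -/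
def BoundaryCondition (Ω : TopologicalSpace.Opens ℝ) (p : ℝ) (α : OnePoint ℝ)
    (ψ : ℝ → ℂ) : Prop :=
  (∀ a : ℝ, α = (a : OnePoint ℝ) → d1 Ω ψ p = (a : ℂ) * ψ p) ∧ (α = OnePoint.infty → ψ p = 0)

/-- The elements of `L²(Ω)` whose `AC²` representative satisfies the boundary condition with
parameter `α` at `p`, for every pair `(p, α)` in `bc`. -/
def boundaryDomain (Ω : TopologicalSpace.Opens ℝ) (bc : Set (ℝ × OnePoint ℝ)) :
    Submodule ℂ (L2 Ω) where
  carrier := {f | ∃ ψ : ℝ → ℂ, IsAC2 Ω ψ ∧ f =ᵐ[volume.restrict (Ω : Set ℝ)] ψ ∧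
    ∀ q ∈ bc, BoundaryCondition Ω q.1 q.2 ψ}
  zero_mem' := ⟨0, isAC2_zero, Lp.coeFn_zero _ _ _, fun q _ => by
    constructor <;> simp [d1]⟩
  add_mem' := by
    rintro f g ⟨ψ, hψ, hf, h⟩ ⟨φ, hφ, hg, k⟩
    refine ⟨ψ + φ, hψ.add hφ, (Lp.coeFn_add f g).trans (hf.add hg), fun q hq => ⟨?_, ?_⟩⟩
    · intro a ha
      have e1 := (h q hq).1 a ha
      have e2 := (k q hq).1 a ha
      by_cases hp : q.1 ∈ closure (Ω : Set ℝ)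
      · rw [hψ.eqOn_d1_add hφ hp, Pi.add_apply, Pi.add_apply, e1, e2]
        ring
      · have z : ∀ χ : ℝ → ℂ, d1 Ω χ q.1 = 0 := fun χ =>
          derivWithin_zero_of_notMem_closure (by rwa [closure_closure])
        rw [z] at e1 e2 ⊢
        rw [Pi.add_apply, mul_add, ← e1, ← e2, add_zero]
    · intro ha
      rw [Pi.add_apply, (h q hq).2 ha, (k q hq).2 ha, add_zero]
  smul_mem' := by
    rintro c f ⟨ψ, hψ, hf, h⟩
    refine ⟨c • ψ, hψ.smul c, (Lp.coeFn_smul c f).trans (hf.const_smul c), fun q hq => ⟨?_, ?_⟩⟩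
    · intro a ha
      have e1 := (h q hq).1 a ha
      by_cases hp : q.1 ∈ closure (Ω : Set ℝ)
      · rw [hψ.eqOn_d1_smul c hp, Pi.smul_apply, Pi.smul_apply, e1, smul_eq_mul, smul_eq_mul]
        ring
      · have z : ∀ χ : ℝ → ℂ, d1 Ω χ q.1 = 0 := fun χ =>
          derivWithin_zero_of_notMem_closure (by rwa [closure_closure])
        rw [z] at e1 ⊢
        rw [Pi.smul_apply, smul_eq_mul, mul_left_comm, ← e1, mul_zero]
    · intro ha
      rw [Pi.smul_apply, (h q hq).2 ha, smul_zero]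

/-- `-d²/dx²` on `boundaryDomain`. -/
def boundaryOperator (Ω : TopologicalSpace.Opens ℝ) (bc : Set (ℝ × OnePoint ℝ)) :
    L2 Ω →ₗ.[ℂ] L2 Ω :=
  (maxOperator Ω).domRestrict (boundaryDomain Ω bc)

lemma boundaryOperator_domain (Ω : TopologicalSpace.Opens ℝ) (bc : Set (ℝ × OnePoint ℝ)) :
    (boundaryOperator Ω bc).domain = boundaryDomain Ω bc :=
  inf_eq_left.2 fun _ ⟨ψ, hψ, hf, _⟩ => ⟨ψ, hψ, hf⟩

/-- `H_α` in `L²(Ω_Λ)`, `α = (α_L, α_R)`. -/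
def Halpha (Λ : ℝ) (αL αR : OnePoint ℝ) : L2 (islands Λ) →ₗ.[ℂ] L2 (islands Λ) :=
  boundaryOperator (islands Λ) {(-Λ, αL), (Λ, αR)}

/-- `H_{α_L}` in `L²(Ω_L)`. -/
def HalphaLeft (Λ : ℝ) (αL : OnePoint ℝ) : L2 (leftIsland Λ) →ₗ.[ℂ] L2 (leftIsland Λ) :=
  boundaryOperator (leftIsland Λ) {(-Λ, αL)}

/-- `H_{α_R}` in `L²(Ω_R)`. -/
def HalphaRight (Λ : ℝ) (αR : OnePoint ℝ) : L2 (rightIsland Λ) →ₗ.[ℂ] L2 (rightIsland Λ) :=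
  boundaryOperator (rightIsland Λ) {(Λ, αR)}

open Classical in
/-- `α_L` as a function of `θ_L`. -/
def alphaLeft (θ : ℝ) : OnePoint ℝ :=
  if θ = Real.pi then OnePoint.infty
  else (((1 + Real.cos θ - Real.sin θ) / (√2 * (1 + Real.cos θ)) : ℝ) : OnePoint ℝ)

open Classical in
/-- `α_R` as a function of `θ_R`. -/
def alphaRight (θ : ℝ) : OnePoint ℝ :=
  if θ = Real.pi then OnePoint.infty
  else ((-((1 + Real.cos θ - Real.sin θ) / (√2 * (1 + Real.cos θ))) : ℝ) : OnePoint ℝ)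

/-! ### Direct sums -/

/-- The direct sum `A ⊕ B` on the Hilbert space direct sum, with domain `D(A) ⊕ D(B)`. -/
def directSum {E F : Type*} [NormedAddCommGroup E] [InnerProductSpace ℂ E]
    [NormedAddCommGroup F] [InnerProductSpace ℂ F] (A : E →ₗ.[ℂ] E) (B : F →ₗ.[ℂ] F) :
    WithLp 2 (E × F) →ₗ.[ℂ] WithLp 2 (E × F) where
  domain :=
    { carrier := {p | p.fst ∈ A.domain ∧ p.snd ∈ B.domain}
      zero_mem' := ⟨zero_mem _, zero_mem _⟩
      add_mem' := fun h k => ⟨add_mem h.1 k.1, add_mem h.2 k.2⟩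
      smul_mem' := fun c _ h => ⟨Submodule.smul_mem _ c h.1, Submodule.smul_mem _ c h.2⟩ }
  toFun :=
    { toFun := fun p => WithLp.toLp 2 (A ⟨p.1.fst, p.2.1⟩, B ⟨p.1.snd, p.2.2⟩)
      map_add' := fun p q => by
        rw [← WithLp.toLp_add, Prod.mk_add_mk, ← LinearPMap.map_add, ← LinearPMap.map_add]
        rfl
      map_smul' := fun c p => by
        rw [RingHom.id_apply, ← WithLp.toLp_smul, Prod.smul_mk, ← LinearPMap.map_smul,
          ← LinearPMap.map_smul]
        rfl }

/-- The unitary map `U` transforms `A` into `B`: `U D(A) = D(B)` and `U A f = B U f`. -/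
def Intertwines {E F : Type*} [NormedAddCommGroup E] [InnerProductSpace ℂ E]
    [NormedAddCommGroup F] [InnerProductSpace ℂ F] (U : E ≃ₗᵢ[ℂ] F)
    (A : E →ₗ.[ℂ] E) (B : F →ₗ.[ℂ] F) : Prop :=
  ∀ f g : E, (f, g) ∈ A.graph ↔ (U f, U g) ∈ B.graph

end Junction

end

namespace Junction

open Filter Topology

/-! ### Primitives of locally integrable functions -/

/-! Everything reduces to linear algebra on boundary data. For `f` in the maximal domain, the
numbers ψ(±Λ), ψ'(±Λ) of its `AC²` representative are well defined. Green's formula shows that the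
failure of symmetry of -d²/dx² is the difference of two boundary forms ψ̄φ' - ψ̄'φ, one at each
boundary point (`inner_maxOperator_sub`). There is no contribution from infinity: a square
integrable function with square integrable second derivative has a square integrable derivative
(`IsH2.memLp_deriv`), so the Wronskian is integrable and has a limit, which must be 0.

The adjoint of `H00` is the maximal operator: test functions have zero boundary data, which gives
one inclusion, and the other is regularity of weak solutions of u'' = q on a half-line, obtained
from du Bois-Reymond's lemma (`exists_isH2_of_weak`). Closing an operator does not change its
adjoint, and the closure is recovered from the adjoint by a double orthogonal complement of the
graph. Hence vectors with zero boundary data lie in D(H₀) (`mem_H0_domain`).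

At one boundary point, the pairs (v, d) allowed by a parameter α form a complex line in ℂ²,
isotropic for the boundary form because α is real or ∞. Isotropy makes `Halpha` symmetric; that such
a line is its own annihilator makes it self-adjoint (`isSelfAdjoint_Halpha`). The vector L₊ + γ_L L₋
has zero data at Λ, and at -Λ its data are a nonzero multiple of (1 + e^{iθ}, ((1-i) +
(1+i)e^{iθ})/√2), which spans the line with parameter (1 - tan(θ/2))/√2; on the right the derivative
changes sign. Subtracting multiples of the two vectors from an element of D(H_α) leaves zero data,
so D(H_γ) = D(H_α) (`gammaDomain_eq`). The bijection holds because each line contains exactly one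
pair of this form.

The decomposition is local: representatives restrict to each island, and can be glued freely since
the gap separates the islands. -/

lemma ac_ofReal {f : ℝ → ℝ} {a b : ℝ} (h : AbsolutelyContinuousOnInterval f a b) :
    AbsolutelyContinuousOnInterval (fun x => (f x : ℂ)) a b := by
  rw [absolutelyContinuousOnInterval_iff] at h ⊢
  simpa only [Complex.isometry_ofReal.dist_eq] using h

/-- Real and imaginary parts are treated separately and recombined. -/
lemma ac_intervalIntegral {f : ℝ → ℂ} {a b c : ℝ} (h : IntervalIntegrable f volume a b)
    (hc : c ∈ uIcc a b) :
    AbsolutelyContinuousOnInterval (fun x => ∫ t in c..x, f t) a b := by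
  have hre : IntervalIntegrable (fun x => (f x).re) volume a b := ⟨h.1.re, h.2.re⟩
  have him : IntervalIntegrable (fun x => (f x).im) volume a b := ⟨h.1.im, h.2.im⟩
  have h1 := (ac_ofReal (hre.absolutelyContinuousOnInterval_intervalIntegral hc)).add
    ((ac_ofReal (him.absolutelyContinuousOnInterval_intervalIntegral hc)).const_smul Complex.I)
  refine ac_congr (fun x hx => ?_) h1
  have hcx : uIcc c x ⊆ uIcc a b := uIcc_subset_uIcc hc hx
  have e : ∀ t, f t = ((f t).re : ℂ) + Complex.I • ((f t).im : ℂ) := fun t => by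
    rw [smul_eq_mul, mul_comm, Complex.re_add_im]
  have i1 : IntervalIntegrable (fun t => ((f t).re : ℂ)) volume c x :=
    have i : IntervalIntegrable (fun t => ((f t).re : ℂ)) volume a b :=
      ⟨Integrable.ofReal hre.1, Integrable.ofReal hre.2⟩
    i.mono_set hcx
  have i2 : IntervalIntegrable (fun t => Complex.I • ((f t).im : ℂ)) volume c x :=
    have i : IntervalIntegrable (fun t => ((f t).im : ℂ)) volume a b :=
      ⟨Integrable.ofReal him.1, Integrable.ofReal him.2⟩
    (i.mono_set hcx).smul Complex.I
  simp only [Pi.add_apply]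
  rw [← intervalIntegral.integral_ofReal, ← intervalIntegral.integral_ofReal,
    ← intervalIntegral.integral_smul, ← intervalIntegral.integral_add i1 i2]
  exact intervalIntegral.integral_congr fun t _ => e t

/-- `f'` is integrable on every compact interval contained in `S`, and `f` is a primitive of `f'`
on each of them. -/
structure IsPrimOn (S : Set ℝ) (f f' : ℝ → ℂ) : Prop where
  integrable : ∀ a b : ℝ, uIcc a b ⊆ S → IntervalIntegrable f' volume a b
  integral_eq : ∀ a b : ℝ, uIcc a b ⊆ S → ∫ t in a..b, f' t = f b - f a

namespace IsPrimOn

variable {S S' : Set ℝ} {f f' g g' : ℝ → ℂ} {a b : ℝ}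

lemma mono (h : IsPrimOn S f f') (hS : S' ⊆ S) : IsPrimOn S' f f' :=
  ⟨fun a b k => h.1 a b (k.trans hS), fun a b k => h.2 a b (k.trans hS)⟩

lemma eq_add (h : IsPrimOn S f f') (hab : uIcc a b ⊆ S) :
    f b = f a + ∫ t in a..b, f' t := by
  rw [h.2 a b hab]; ring

lemma ac (h : IsPrimOn S f f') (hab : uIcc a b ⊆ S) : AbsolutelyContinuousOnInterval f a b := by
  have h1 := ac_intervalIntegral (h.1 a b hab) (left_mem_uIcc (a := a) (b := b))
  have h2 : AbsolutelyContinuousOnInterval (fun _ : ℝ => f a) a b :=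
    (contDiff_const (n := 1)).contDiffOn.absolutelyContinuousOnInterval
  refine ac_congr (fun x hx => ?_) (h2.add h1)
  exact h.eq_add ((uIcc_subset_uIcc_left hx).trans hab)

lemma continuousOn (h : IsPrimOn S f f') (hab : uIcc a b ⊆ S) : ContinuousOn f (uIcc a b) :=
  (h.ac hab).continuousOn

lemma ae_hasDerivAt (h : IsPrimOn S f f') (hab : uIcc a b ⊆ S) :
    ∀ᵐ x, x ∈ uIcc a b → HasDerivAt f (f' x) x := by
  -- The two endpoints form a null set; away from them the interval is a neighbourhood of `x`, so
  -- the local formula for `f` can be differentiated.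
  have ha : ∀ᵐ x : ℝ, x ≠ a := by simp [ae_iff, measure_singleton]
  have hb : ∀ᵐ x : ℝ, x ≠ b := by simp [ae_iff, measure_singleton]
  filter_upwards [(h.1 a b hab).ae_hasDerivAt_integral, ha, hb] with x hx hxa hxb hxm
  have h1 := (hx hxm a left_mem_uIcc).const_add (f a)
  refine h1.congr_of_eventuallyEq ?_
  have hn : uIcc a b ∈ 𝓝 x := by
    refine Icc_mem_nhds (lt_of_le_of_ne hxm.1 ?_) (lt_of_le_of_ne hxm.2 ?_)
    · rcases min_choice a b with e | e <;> rw [e] <;> exact Ne.symm ‹_›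
    · rcases max_choice a b with e | e <;> rw [e] <;> assumption
  filter_upwards [hn] with y hy
  exact h.eq_add ((uIcc_subset_uIcc_left hy).trans hab)

/-- Subtracting the primitive of `f'` from `f` leaves an absolutely continuous function with
derivative zero almost everywhere, hence a constant. -/
lemma of_ac (hac : ∀ a b : ℝ, uIcc a b ⊆ S → AbsolutelyContinuousOnInterval f a b)
    (hint : ∀ a b : ℝ, uIcc a b ⊆ S → IntervalIntegrable f' volume a b)
    (hd : ∀ a b : ℝ, uIcc a b ⊆ S → ∀ᵐ x, x ∈ uIcc a b → HasDerivAt f (f' x) x) :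
    IsPrimOn S f f' := by
  refine ⟨hint, fun a b hab => ?_⟩
  have i := hint a b hab
  have h1 := (hac a b hab).sub (ac_intervalIntegral i (left_mem_uIcc (a := a) (b := b)))
  obtain ⟨C, hC⟩ := h1.const_of_ae_hasDerivAt_zero (by
    filter_upwards [hd a b hab, i.ae_hasDerivAt_integral] with x h2 h3 hx
    have := (h2 hx).sub (h3 hx a left_mem_uIcc)
    rwa [sub_self] at this)
  have e1 := hC a left_mem_uIcc
  have e2 := hC b right_mem_uIcc
  simp only [Pi.sub_apply, intervalIntegral.integral_same, sub_zero] at e1 e2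
  rw [e1, ← e2]; ring

lemma of_hasDerivAt (hd : ∀ x, HasDerivAt f (f' x) x) (hc : Continuous f') : IsPrimOn S f f' :=
  ⟨fun _ _ _ => hc.intervalIntegrable _ _, fun a b _ =>
    intervalIntegral.integral_eq_sub_of_hasDerivAt (fun x _ => hd x) (hc.intervalIntegrable a b)⟩

/-- The product rule; every integration by parts below is an instance of it. -/
lemma mul (hf : IsPrimOn S f f') (hg : IsPrimOn S g g') :
    IsPrimOn S (fun x => f x * g x) (fun x => f' x * g x + f x * g' x) := by
  refine of_ac (fun a b h => (hf.ac h).smul (hg.ac h)) (fun a b h => ?_) fun a b h => ?_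
  · exact ((hf.1 a b h).mul_continuousOn (hg.continuousOn h)).add
      ((hg.1 a b h).continuousOn_mul (hf.continuousOn h))
  · filter_upwards [hf.ae_hasDerivAt h, hg.ae_hasDerivAt h] with x h1 h2 hx
    exact (h1 hx).mul (h2 hx)

lemma add (hf : IsPrimOn S f f') (hg : IsPrimOn S g g') :
    IsPrimOn S (fun x => f x + g x) (fun x => f' x + g' x) :=
  ⟨fun a b h => (hf.1 a b h).add (hg.1 a b h), fun a b h => by
    rw [intervalIntegral.integral_add (hf.1 a b h) (hg.1 a b h), hf.2 a b h, hg.2 a b h]; ring⟩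

lemma sub (hf : IsPrimOn S f f') (hg : IsPrimOn S g g') :
    IsPrimOn S (fun x => f x - g x) (fun x => f' x - g' x) :=
  ⟨fun a b h => (hf.1 a b h).sub (hg.1 a b h), fun a b h => by
    rw [intervalIntegral.integral_sub (hf.1 a b h) (hg.1 a b h), hf.2 a b h, hg.2 a b h]; ring⟩

lemma neg (hf : IsPrimOn S f f') : IsPrimOn S (fun x => -f x) (fun x => -f' x) :=
  ⟨fun a b h => (hf.1 a b h).neg, fun a b h => by
    rw [intervalIntegral.integral_neg, hf.2 a b h]; ring⟩

lemma conj (hf : IsPrimOn S f f') :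
    IsPrimOn S (fun x => (starRingEnd ℂ) (f x)) (fun x => (starRingEnd ℂ) (f' x)) := by
  refine ⟨fun a b h => ?_, fun a b h => ?_⟩
  · exact ⟨Complex.conjCLE.toContinuousLinearMap.integrable_comp (hf.1 a b h).1,
      Complex.conjCLE.toContinuousLinearMap.integrable_comp (hf.1 a b h).2⟩
  · rw [← map_sub, ← hf.2 a b h]
    exact Complex.conjCLE.toContinuousLinearMap.intervalIntegral_comp_comm (hf.1 a b h)

/-- Reflection turns the left island into the right one, so the analysis is done only on half-lines
[a, ∞). -/
lemma comp_neg (hf : IsPrimOn S f f') :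
    IsPrimOn (Neg.neg ⁻¹' S) (fun x => f (-x)) (fun x => -f' (-x)) := by
  have key : ∀ a b : ℝ, uIcc a b ⊆ Neg.neg ⁻¹' S → uIcc (-a) (-b) ⊆ S := by
    intro a b h x hx
    have : -x ∈ uIcc a b := by
      rw [← neg_neg a, ← neg_neg b, ← image_neg_uIcc]; exact ⟨x, hx, rfl⟩
    simpa using h this
  refine ⟨fun a b h => ?_, fun a b h => ?_⟩
  · have := (hf.1 _ _ (key a b h))
    have h2 := ((IntervalIntegrable.iff_comp_neg).1 this).neg
    simp only [neg_neg] at h2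
    exact h2
  · rw [intervalIntegral.integral_neg, intervalIntegral.integral_comp_neg,
      intervalIntegral.integral_symm, hf.2 _ _ (key a b h), neg_neg]

lemma congr {F F' : ℝ → ℂ} (hf : IsPrimOn S f f') (h : EqOn F f S) (h' : EqOn F' f' S) :
    IsPrimOn S F F' := by
  refine ⟨fun a b k => (hf.1 a b k).congr ?_, fun a b k => ?_⟩
  · intro x hx
    exact (h' (k (uIoc_subset_uIcc hx))).symm
  · rw [h (k left_mem_uIcc), h (k right_mem_uIcc), ← hf.2 a b k]
    exact intervalIntegral.integral_congr fun x hx => h' (k hx)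

lemma hasDerivWithinAt (hf : IsPrimOn S f f') {x : ℝ} (hS : Icc a b ⊆ S) (hx : x ∈ Icc a b)
    (hc : ContinuousOn f' (Icc a b)) : HasDerivWithinAt f (f' x) (Icc a b) x := by
  have hab : a ≤ b := hx.1.trans hx.2
  have hu : uIcc a b ⊆ S := by rwa [uIcc_of_le hab]
  have : Fact (x ∈ Icc a b) := ⟨hx⟩
  have hx' : uIcc a x ⊆ S := by
    rw [uIcc_of_le hx.1]; exact (Icc_subset_Icc_right hx.2).trans hS
  have h1 := (intervalIntegral.integral_hasDerivWithinAt_right (s := Icc a b) (hf.1 a x hx')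
    (hc.stronglyMeasurableAtFilter_nhdsWithin measurableSet_Icc x) (hc x hx)).const_add (f a)
  refine h1.congr (fun y hy => ?_) ?_
  · refine hf.eq_add ?_
    rw [uIcc_of_le hy.1]; exact (Icc_subset_Icc_right hy.2).trans hS
  · exact hf.eq_add hx'

end IsPrimOn

/-! ### Characterization of the class `AC²` by primitives -/

/-- The closure of `Ω` differs from `Ω` by a null set, and near each of its points it is a
nondegenerate compact interval. -/
structure IsRegular (Ω : TopologicalSpace.Opens ℝ) : Prop where
  ae_eq : (Ω : Set ℝ) =ᵐ[volume] closure (Ω : Set ℝ)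
  exists_Icc : ∀ x ∈ closure (Ω : Set ℝ), ∃ a b : ℝ, a < b ∧ x ∈ Icc a b ∧
    Icc a b ⊆ closure (Ω : Set ℝ) ∧ Icc a b ∈ 𝓝[closure (Ω : Set ℝ)] x

/-- Off the endpoints of a compact interval the derivative within the closure is an ordinary
derivative; its absolute continuity makes it continuous, hence integrable. -/
lemma IsAC2.isPrimOn_d1 {Ω : TopologicalSpace.Opens ℝ} {ψ : ℝ → ℂ} (hψ : IsAC2 Ω ψ) :
    IsPrimOn (closure (Ω : Set ℝ)) ψ (d1 Ω ψ) := by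
  refine .of_ac hψ.ac (fun a b h => (hψ.ac_d1 a b h).continuousOn.intervalIntegrable)
    fun a b h => ?_
  have ha : ∀ᵐ x : ℝ, x ≠ min a b := by simp [ae_iff, measure_singleton]
  have hb : ∀ᵐ x : ℝ, x ≠ max a b := by simp [ae_iff, measure_singleton]
  filter_upwards [ha, hb] with x hxa hxb hx
  have hn : closure (Ω : Set ℝ) ∈ 𝓝 x := mem_of_superset
    (Icc_mem_nhds (lt_of_le_of_ne hx.1 hxa.symm) (lt_of_le_of_ne hx.2 hxb)) h
  exact ((hψ.diff x (h hx)).hasDerivWithinAt).hasDerivAt hn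

namespace IsRegular

variable {Ω : TopologicalSpace.Opens ℝ} (hΩ : IsRegular Ω)

include hΩ

lemma uniqueDiffOn : UniqueDiffOn ℝ (closure (Ω : Set ℝ)) := fun x hx => by
  obtain ⟨a, b, hab, hx, hs, -⟩ := hΩ.exists_Icc x hx
  exact (uniqueDiffOn_Icc hab x hx).mono hs

lemma intervalIntegrable {q : ℝ → ℂ} (hq : MemLp q 2 (volume.restrict (Ω : Set ℝ))) {a b : ℝ}
    (hab : uIcc a b ⊆ closure (Ω : Set ℝ)) : IntervalIntegrable q volume a b := by
  rw [Measure.restrict_congr_set hΩ.ae_eq] at hq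
  have h1 : MemLp q 2 (volume.restrict (uIcc a b)) :=
    hq.mono_measure (Measure.restrict_mono hab le_rfl)
  have : IsFiniteMeasure (volume.restrict (uIcc a b)) :=
    isFiniteMeasure_restrict.2 isCompact_uIcc.measure_lt_top.ne
  have : IntegrableOn q (uIcc a b) := h1.integrable (by norm_num)
  exact this.intervalIntegrable

lemma continuousOn {p q : ℝ → ℂ} (hp : IsPrimOn (closure (Ω : Set ℝ)) p q) :
    ContinuousOn p (closure (Ω : Set ℝ)) := fun x hx => by
  obtain ⟨a, b, hab, hx, hs, hn⟩ := hΩ.exists_Icc x hx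
  have := hp.continuousOn (a := a) (b := b) (by rwa [uIcc_of_le hab.le])
  rw [uIcc_of_le hab.le] at this
  exact (this x hx).mono_of_mem_nhdsWithin hn

lemma hasDerivWithinAt {u p q : ℝ → ℂ} (hu : IsPrimOn (closure (Ω : Set ℝ)) u p)
    (hp : IsPrimOn (closure (Ω : Set ℝ)) p q) {x : ℝ} (hx : x ∈ closure (Ω : Set ℝ)) :
    HasDerivWithinAt u (p x) (closure (Ω : Set ℝ)) x := by
  obtain ⟨a, b, hab, hx, hs, hn⟩ := hΩ.exists_Icc x hx
  exact (hu.hasDerivWithinAt hs hx ((hΩ.continuousOn hp).mono hs)).mono_of_mem_nhdsWithin hn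

lemma eqOn_d1 {u p q : ℝ → ℂ} (hu : IsPrimOn (closure (Ω : Set ℝ)) u p)
    (hp : IsPrimOn (closure (Ω : Set ℝ)) p q) : EqOn (d1 Ω u) p (closure (Ω : Set ℝ)) :=
  fun x hx => (hΩ.hasDerivWithinAt hu hp hx).derivWithin (hΩ.uniqueDiffOn x hx)

lemma ae_hasDerivWithinAt {p q : ℝ → ℂ} (hp : IsPrimOn (closure (Ω : Set ℝ)) p q) :
    ∀ᵐ x ∂volume.restrict (Ω : Set ℝ), HasDerivWithinAt p (q x) (closure (Ω : Set ℝ)) x := by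
  rw [ae_restrict_iff' Ω.isOpen.measurableSet, ae_iff]
  -- Being null is a local property, so the statement on compact intervals suffices.
  refine measure_null_of_locally_null _ fun x hx => ?_
  simp only [mem_ofPred_eq, Classical.not_imp] at hx
  obtain ⟨a, b, hab, hxm, hs, hn⟩ := hΩ.exists_Icc x (subset_closure hx.1)
  have hu : uIcc a b ⊆ closure (Ω : Set ℝ) := by rwa [uIcc_of_le hab.le]
  have hae := hp.ae_hasDerivAt hu
  rw [ae_iff] at hae
  have hn' : Icc a b ∈ 𝓝 x := by
    have : closure (Ω : Set ℝ) ∈ 𝓝 x :=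
      mem_of_superset (Ω.isOpen.mem_nhds hx.1) subset_closure
    rwa [nhdsWithin_eq_nhds.2 this] at hn
  refine ⟨_, inter_mem_nhdsWithin _ hn', measure_mono_null ?_ hae⟩
  rintro y ⟨hy, hy'⟩
  simp only [mem_ofPred_eq, Classical.not_imp] at hy ⊢
  exact ⟨by rwa [uIcc_of_le hab.le], fun hd => hy.2 hd.hasDerivWithinAt⟩

lemma d2_ae_eq {u p q : ℝ → ℂ} (hu : IsPrimOn (closure (Ω : Set ℝ)) u p)
    (hp : IsPrimOn (closure (Ω : Set ℝ)) p q) :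
    d2 Ω u =ᵐ[volume.restrict (Ω : Set ℝ)] q := by
  filter_upwards [hΩ.ae_hasDerivWithinAt hp, ae_restrict_mem Ω.isOpen.measurableSet] with x h hx
  have hx' := subset_closure hx
  rw [d2, d1, derivWithin_congr (hΩ.eqOn_d1 hu hp) (hΩ.eqOn_d1 hu hp hx')]
  exact h.derivWithin (hΩ.uniqueDiffOn x hx')

/-- Converse to `IsAC2.isPrimOn_d1` and `isPrimOn_d2`: membership in `AC²` amounts to being a
twofold primitive of a square integrable function. Restriction, gluing and reflection are all
carried out in this form. -/
lemma isAC2_of_isPrimOn {u p q : ℝ → ℂ} (hu : IsPrimOn (closure (Ω : Set ℝ)) u p)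
    (hp : IsPrimOn (closure (Ω : Set ℝ)) p q) (hq : MemLp q 2 (volume.restrict (Ω : Set ℝ))) :
    IsAC2 Ω u where
  ac _ _ h := hu.ac h
  diff _ hx := (hΩ.hasDerivWithinAt hu hp hx).differentiableWithinAt
  ac_d1 _ _ h := ac_congr ((hΩ.eqOn_d1 hu hp).mono h) (hp.ac h)
  memLp_d2 := (memLp_congr_ae (hΩ.d2_ae_eq hu hp)).2 hq

lemma isPrimOn_d2 {ψ : ℝ → ℂ} (hψ : IsAC2 Ω ψ) :
    IsPrimOn (closure (Ω : Set ℝ)) (d1 Ω ψ) (d2 Ω ψ) := by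
  refine .of_ac hψ.ac_d1 (fun a b h => hΩ.intervalIntegrable hψ.memLp_d2 h)
    fun a b h => ?_
  have ha : ∀ᵐ x : ℝ, x ≠ min a b := by simp [ae_iff, measure_singleton]
  have hb : ∀ᵐ x : ℝ, x ≠ max a b := by simp [ae_iff, measure_singleton]
  filter_upwards [ha, hb, (hψ.ac_d1 a b h).boundedVariationOn.ae_differentiableAt_of_mem_uIcc]
    with x hxa hxb hd hx
  have hn : closure (Ω : Set ℝ) ∈ 𝓝 x := mem_of_superset
    (Icc_mem_nhds (lt_of_le_of_ne hx.1 hxa.symm) (lt_of_le_of_ne hx.2 hxb)) h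
  have e : d2 Ω ψ x = deriv (d1 Ω ψ) x := derivWithin_of_mem_nhds hn
  exact e ▸ (hd hx).hasDerivAt

end IsRegular

/-! ### Square integrable functions with square integrable second derivative on a half-line -/

lemma uIcc_subset_Ici {a b c : ℝ} (hb : a ≤ b) (hc : a ≤ c) : uIcc b c ⊆ Ici a :=
  fun _ hx => (le_min hb hc).trans hx.1

lemma integrableOn_mul_of_memLp {S : Set ℝ} {f g : ℝ → ℂ} (hf : MemLp f 2 (volume.restrict S))
    (hg : MemLp g 2 (volume.restrict S)) : IntegrableOn (fun x => f x * g x) S :=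
  hf.integrable_mul hg

lemma memLp_conj {μ : Measure ℝ} {f : ℝ → ℂ} (hf : MemLp f 2 μ) :
    MemLp (fun x => (starRingEnd ℂ) (f x)) 2 μ := hf.star

/-- `u` and `q` are square integrable on `(a, ∞)`, and `u' = p`, `p' = q` on `[a, ∞)`. -/
structure IsH2 (a : ℝ) (u p q : ℝ → ℂ) : Prop where
  prim : IsPrimOn (Ici a) u p
  prim' : IsPrimOn (Ici a) p q
  memLp : MemLp u 2 (volume.restrict (Ioi a))
  memLp' : MemLp q 2 (volume.restrict (Ioi a))

namespace IsH2

variable {a : ℝ} {u p q v r s : ℝ → ℂ}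

lemma conj (h : IsH2 a u p q) : IsH2 a (fun x => (starRingEnd ℂ) (u x))
    (fun x => (starRingEnd ℂ) (p x)) (fun x => (starRingEnd ℂ) (q x)) :=
  ⟨h.prim.conj, h.prim'.conj, memLp_conj h.memLp, memLp_conj h.memLp'⟩

lemma continuousOn_deriv (h : IsH2 a u p q) : ContinuousOn p (Ici a) := fun x hx => by
  have h1 := h.prim'.continuousOn (uIcc_subset_Ici le_rfl (le_add_of_le_of_nonneg hx zero_le_one))
  rw [uIcc_of_le (le_add_of_le_of_nonneg hx zero_le_one)] at h1
  refine (h1 x ⟨hx, by linarith⟩).mono_of_mem_nhdsWithin ?_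
  rw [← Ici_inter_Iic]
  exact inter_mem self_mem_nhdsWithin (mem_nhdsWithin_of_mem_nhds (Iic_mem_nhds (by linarith)))

/-- The integral is nondecreasing in its upper limit, so it either stays bounded, which forces
integrability, or tends to infinity. -/
lemma tendsto_sq_integral_deriv (h : IsH2 a u p q)
    (hp : ¬ IntegrableOn (fun x => ‖p x‖ ^ 2) (Ioi a)) :
    Tendsto (fun b => ∫ x in a..b, ‖p x‖ ^ 2) atTop atTop := by
  have hi : ∀ b c, a ≤ b → a ≤ c → IntervalIntegrable (fun x => ‖p x‖ ^ 2) volume b c :=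
    fun b c hb hc => ((h.continuousOn_deriv.mono (uIcc_subset_Ici hb hc)).norm.pow
      2).intervalIntegrable
  rw [tendsto_atTop]
  intro C
  by_contra hC
  refine hp (integrableOn_Ioi_of_intervalIntegral_norm_bounded (l := atTop)
    (b := fun n : ℕ => a + n) C a (fun n => ?_)
    (tendsto_atTop_add_const_left _ _ tendsto_natCast_atTop_atTop) (Eventually.of_forall fun n => ?_))
  · exact (hi a (a + n) le_rfl (by simp)).1
  · rw [not_eventually] at hC
    obtain ⟨b, hb, hb'⟩ := (hC.and_eventually (eventually_ge_atTop (a + n))).exists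
    rw [not_le] at hb
    have hab : a ≤ b := le_trans (by simp) hb'
    simp only [norm_pow, norm_norm]
    refine le_trans ?_ hb.le
    rw [← intervalIntegral.integral_add_adjacent_intervals (hi a (a + n) le_rfl (by simp))
      (hi (a + n) b (by simp) hab)]
    exact le_add_of_nonneg_right (intervalIntegral.integral_nonneg hb' fun _ _ => by positivity)

/-- The derivative of a square integrable function with square integrable second derivative is
square integrable. -/
lemma memLp_deriv (h : IsH2 a u p q) : MemLp p 2 (volume.restrict (Ioi a)) := by
  have hmeas : AEStronglyMeasurable p (volume.restrict (Ioi a)) :=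
    (h.continuousOn_deriv.mono Ioi_subset_Ici_self).aestronglyMeasurable measurableSet_Ioi
  rw [memLp_two_iff_integrable_sq_norm hmeas]
  by_contra hp
  have h1 := h.tendsto_sq_integral_deriv hp
  have hc := h.conj
  have hI : IntegrableOn (fun x => u x * (starRingEnd ℂ) (q x)) (Ioi a) :=
    integrableOn_mul_of_memLp h.memLp hc.memLp'
  -- Integrate (u p̄)' = |p|² + u q̄ and take real parts; the last term is integrable by
  -- Cauchy-Schwarz.
  have e : ∀ b, a ≤ b → (u b * (starRingEnd ℂ) (p b)).re =
      (∫ x in a..b, ‖p x‖ ^ 2) + ((u a * (starRingEnd ℂ) (p a)).re +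
        (∫ x in a..b, u x * (starRingEnd ℂ) (q x)).re) := by
    intro b hb
    have hs := uIcc_subset_Ici (le_refl a) hb
    have h2 := (h.prim.mul hc.prim').eq_add hs
    have i1 : IntervalIntegrable (fun x => p x * (starRingEnd ℂ) (p x)) volume a b :=
      ((h.continuousOn_deriv.mono hs).mul (hc.continuousOn_deriv.mono hs)).intervalIntegrable
    have i2 : IntervalIntegrable (fun x => u x * (starRingEnd ℂ) (q x)) volume a b :=
      (intervalIntegrable_iff_integrableOn_Ioc_of_le hb).2 (hI.mono_set Ioc_subset_Ioi_self)
    rw [intervalIntegral.integral_add i1 i2] at h2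
    have e1 : ∫ x in a..b, p x * (starRingEnd ℂ) (p x) = ((∫ x in a..b, ‖p x‖ ^ 2 : ℝ) : ℂ) := by
      rw [← intervalIntegral.integral_ofReal]
      refine intervalIntegral.integral_congr fun x _ => ?_
      simp only [Complex.mul_conj, Complex.normSq_eq_norm_sq]
    rw [h2, e1]
    simp only [Complex.add_re, Complex.ofReal_re]
    ring
  -- If ∫|p|² diverges, then Re(u p̄), which is half the derivative of |u|², tends to infinity.
  have h2 : Tendsto (fun b => (u b * (starRingEnd ℂ) (p b)).re) atTop atTop := by
    have h3 := intervalIntegral_tendsto_integral_Ioi a hI tendsto_id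
    have h4 := (Complex.continuous_re.tendsto _).comp h3
    have h5 := h1.atTop_add (tendsto_const_nhds (x := (u a * (starRingEnd ℂ) (p a)).re)|>.add h4)
    refine h5.congr' ?_
    filter_upwards [eventually_ge_atTop a] with b hb
    exact (e b hb).symm
  obtain ⟨c, hc1⟩ := eventually_atTop.1 ((h2.eventually_ge_atTop 1).and (eventually_ge_atTop a))
  have hac : a ≤ c := (hc1 c le_rfl).2
  have hU : IntegrableOn (fun x => ‖u x‖ ^ 2) (Ioi a) :=
    (memLp_two_iff_integrable_sq_norm h.memLp.1).1 h.memLp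
  -- Beyond `c` the derivative of |u|² is at least 2, so |u|² grows at least linearly. This
  -- contradicts u ∈ L².
  have h6 : ∀ b, c ≤ b → 2 * (b - c) ≤ ‖u b‖ ^ 2 := by
    intro b hb
    have hs : uIcc c b ⊆ Ici a := uIcc_subset_Ici hac (hac.trans hb)
    have h7 := (h.prim.mul hc.prim).eq_add hs
    have e2 : ∫ x in c..b, (p x * (starRingEnd ℂ) (u x) + u x * (starRingEnd ℂ) (p x)) =
        ((∫ x in c..b, 2 * (u x * (starRingEnd ℂ) (p x)).re : ℝ) : ℂ) := by
      rw [← intervalIntegral.integral_ofReal]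
      refine intervalIntegral.integral_congr fun x _ => ?_
      apply Complex.ext <;> simp <;> ring
    rw [e2] at h7
    simp only [Complex.mul_conj, Complex.normSq_eq_norm_sq] at h7
    have h8 : ‖u b‖ ^ 2 = ‖u c‖ ^ 2 + ∫ x in c..b, 2 * (u x * (starRingEnd ℂ) (p x)).re := by
      exact_mod_cast h7
    have h9 : ∫ x in c..b, (2 : ℝ) ≤ ∫ x in c..b, 2 * (u x * (starRingEnd ℂ) (p x)).re := by
      refine intervalIntegral.integral_mono_on hb intervalIntegrable_const ?_ fun x hx => ?_
      · refine ContinuousOn.intervalIntegrable ?_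
        exact continuousOn_const.mul (Complex.continuous_re.comp_continuousOn
          ((h.prim.continuousOn hs).mul (hc.continuousOn_deriv.mono hs)))
      · linarith [(hc1 x hx.1).1]
    rw [intervalIntegral.integral_const, smul_eq_mul] at h9
    rw [h8]
    nlinarith [sq_nonneg ‖u c‖]
  have h10 : IntegrableOn (fun _ : ℝ => (1 : ℝ)) (Ioi (c + 1)) := by
    refine (hU.mono_set (Ioi_subset_Ioi (by linarith))).mono' (by fun_prop) ?_
    filter_upwards [ae_restrict_mem measurableSet_Ioi] with x hx
    have := h6 x (by linarith [mem_Ioi.1 hx])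
    rw [norm_one]
    linarith [mem_Ioi.1 hx]
  rw [integrableOn_const_iff] at h10
  simp at h10

/-- Green's formula on a half-line. -/
lemma green (h : IsH2 a u p q) (k : IsH2 a v r s) :
    ∫ x in Ioi a, (u x * s x - q x * v x) = p a * v a - u a * r a := by
  have i : IntegrableOn (fun x => u x * s x - q x * v x) (Ioi a) :=
    (integrableOn_mul_of_memLp h.memLp k.memLp').sub (integrableOn_mul_of_memLp h.memLp' k.memLp)
  -- The Wronskian is integrable by `memLp_deriv`, and it converges at infinity because its
  -- derivative is integrable. On a half-line of infinite measure the limit can only be 0.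
  have W : IntegrableOn (fun x => u x * r x - p x * v x) (Ioi a) :=
    (integrableOn_mul_of_memLp h.memLp k.memLp_deriv).sub
      (integrableOn_mul_of_memLp h.memLp_deriv k.memLp)
  have h1 := (h.prim.mul k.prim').sub (h.prim'.mul k.prim)
  have h2 := intervalIntegral_tendsto_integral_Ioi a i tendsto_id
  have h3 : Tendsto (fun b => u b * r b - p b * v b) atTop
      (𝓝 ((u a * r a - p a * v a) + ∫ x in Ioi a, (u x * s x - q x * v x))) := by
    refine (tendsto_const_nhds.add h2).congr' ?_
    filter_upwards [eventually_ge_atTop a] with b hb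
    rw [h1.eq_add (uIcc_subset_Ici (le_refl a) hb)]
    congr 1
    exact intervalIntegral.integral_congr fun x _ => by ring
  have h4 := IntegrableAtFilter.eq_zero_of_tendsto (μ := volume) ⟨Ioi a, Ioi_mem_atTop a, W⟩
    (fun S hS => by
      obtain ⟨b, hb⟩ := mem_atTop_sets.1 hS
      rw [← top_le_iff, ← Real.volume_Ici (a := b)]
      exact measure_mono hb) h3
  linear_combination h4

end IsH2

/-! ### Weak solutions on a half-line -/

/-- `φ` is a real test function on `S`. -/
structure IsTest (S : Set ℝ) (φ : ℝ → ℝ) : Prop where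
  smooth : ContDiff ℝ ∞ φ
  compact : HasCompactSupport φ
  subset : tsupport φ ⊆ S

namespace IsTest

variable {S : Set ℝ} {φ χ : ℝ → ℝ} {a : ℝ}

lemma deriv (h : IsTest S φ) : IsTest S (deriv φ) :=
  ⟨ContDiff.deriv' h.smooth, h.compact.deriv, tsupport_deriv_subset.trans h.subset⟩

lemma hasDerivAt (h : IsTest S φ) (x : ℝ) : HasDerivAt φ (_root_.deriv φ x) x :=
  (h.smooth.differentiable (by simp)).differentiableAt.hasDerivAt

lemma sub_const_mul (h : IsTest S φ) (k : IsTest S χ) (c : ℝ) :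
    IsTest S (fun x => φ x - c * χ x) :=
  ⟨h.smooth.sub (contDiff_const.mul k.smooth), h.compact.sub (k.compact.mul_left (f := fun _ => c)),
    (tsupport_sub φ _).trans (union_subset h.subset
      ((tsupport_mul_subset_right (f := fun _ => c)).trans k.subset))⟩

lemma integrable (h : IsTest S φ) : Integrable φ :=
  h.smooth.continuous.integrable_of_hasCompactSupport h.compact

lemma exists_Ioo (h : IsTest (Ioi a) φ) : ∃ c d : ℝ, a < c ∧ c < d ∧ tsupport φ ⊆ Ioo c d := by
  rcases (tsupport φ).eq_empty_or_nonempty with e | hne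
  · exact ⟨a + 1, a + 2, by linarith, by linarith, by simp [e]⟩
  · obtain ⟨x, hx, hx'⟩ := h.compact.isCompact.exists_isLeast hne
    obtain ⟨y, hy, hy'⟩ := h.compact.isCompact.exists_isGreatest hne
    have hax : a < x := h.subset hx
    have hxy : x ≤ y := hx' hy
    refine ⟨(a + x) / 2, y + 1, by linarith, by linarith, fun z hz => ⟨?_, ?_⟩⟩
    · linarith [hx' hz]
    · linarith [hy' hz]

lemma integrable_smul {w : ℝ → ℂ} (h : IsTest S φ)
    (hw : LocallyIntegrableOn w S) : Integrable (fun x => φ x • w x) := by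
  have h1 : IntegrableOn w (tsupport φ) := hw.integrableOn_compact_subset h.subset h.compact
  have h2 : IntegrableOn (fun x => φ x • w x) (tsupport φ) :=
    h1.continuousOn_smul h.smooth.continuous.continuousOn h.compact
  refine (integrableOn_iff_integrable_of_support_subset fun x hx => ?_).1 h2
  refine subset_tsupport φ fun h0 => hx ?_
  simp [h0]

/-- Integration by parts against a test function. -/
lemma integral_deriv_smul (h : IsTest (Ioi a) φ) {F F' : ℝ → ℂ} (hF : IsPrimOn (Ioi a) F F') :
    ∫ x, _root_.deriv φ x • F x = -∫ x, φ x • F' x := by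
  obtain ⟨c, d, hac, hcd, hs⟩ := h.exists_Ioo
  have hu : uIcc c d ⊆ Ioi a := fun x hx => by
    rw [uIcc_of_le hcd.le] at hx; exact hac.trans_le hx.1
  have hφ : IsPrimOn (Ioi a) (fun x => (φ x : ℂ)) (fun x => ((_root_.deriv φ x : ℝ) : ℂ)) :=
    .of_hasDerivAt (fun x => (h.hasDerivAt x).ofReal_comp)
      (Complex.continuous_ofReal.comp h.deriv.smooth.continuous)
  have h0 : ∀ x, x ∉ Ioo c d → φ x = 0 := fun x hx => by
    by_contra hne
    exact hx (hs (subset_tsupport φ hne))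
  have h0' : ∀ x, x ∉ Ioo c d → _root_.deriv φ x = 0 := fun x hx => by
    by_contra hne
    exact hx (hs (tsupport_deriv_subset (subset_tsupport _ hne)))
  have e1 : ∫ x in c..d, _root_.deriv φ x • F x = ∫ x, _root_.deriv φ x • F x :=
    intervalIntegral.integral_eq_integral_of_support_subset fun x hx => by
      by_contra hne
      exact hx (by simp [h0' x fun k => hne (Ioo_subset_Ioc_self k)])
  have e2 : ∫ x in c..d, φ x • F' x = ∫ x, φ x • F' x :=
    intervalIntegral.integral_eq_integral_of_support_subset fun x hx => by
      by_contra hne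
      exact hx (by simp [h0 x fun k => hne (Ioo_subset_Ioc_self k)])
  have h1 := (hφ.mul hF).2 c d hu
  rw [h0 c (by simp), h0 d (by simp), intervalIntegral.integral_add
    ((hφ.1 c d hu).mul_continuousOn (hF.continuousOn hu))
    ((hF.1 c d hu).continuousOn_mul (hφ.continuousOn hu))] at h1
  simp only [← Complex.real_smul] at h1
  rw [e1, e2] at h1
  simp only [zero_smul, sub_self] at h1
  exact eq_neg_of_add_eq_zero_left h1

/-- The vanishing mean makes the primitive vanish again to the right of the support, so that it is a
test function. -/
lemma exists_primitive (h : IsTest (Ioi a) φ) (h0 : ∫ x, φ x = 0) :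
    ∃ η, IsTest (Ioi a) η ∧ _root_.deriv η = φ := by
  obtain ⟨c, d, hac, hcd, hs⟩ := h.exists_Ioo
  have hd : ∀ x, HasDerivAt (fun x => ∫ t in c..x, φ t) (φ x) x := fun x =>
    h.smooth.continuous.integral_hasStrictDerivAt c x |>.hasDerivAt
  have hde : _root_.deriv (fun x => ∫ t in c..x, φ t) = φ := funext fun x => (hd x).deriv
  have hz : ∀ x, x ∉ Ioo c d → φ x = 0 := fun x hx => by
    by_contra hne
    exact hx (hs (subset_tsupport φ hne))
  have hsupp : Function.support (fun x => ∫ t in c..x, φ t) ⊆ Icc c d := by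
    intro x hx
    by_contra hx'
    refine hx ?_
    rw [mem_Icc, not_and_or, not_le, not_le] at hx'
    rcases hx' with hx' | hx'
    · refine (intervalIntegral.integral_congr (g := fun _ => 0) fun t ht => hz t fun k => ?_).trans
        (by simp)
      rw [uIcc_of_ge hx'.le] at ht
      exact absurd k.1 (not_lt.2 ht.2)
    · change ∫ t in c..x, φ t = 0
      rw [intervalIntegral.integral_eq_integral_of_support_subset, h0]
      intro t ht
      by_contra hne
      exact ht (hz t fun k => hne ⟨k.1, k.2.le.trans hx'.le⟩)
  have hts : tsupport (fun x => ∫ t in c..x, φ t) ⊆ Icc c d := closure_minimal hsupp isClosed_Icc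
  refine ⟨_, ⟨?_, HasCompactSupport.of_support_subset_isCompact isCompact_Icc hsupp,
    hts.trans fun x hx => hac.trans_le hx.1⟩, hde⟩
  rw [contDiff_infty_iff_deriv, hde]
  exact ⟨fun x => (hd x).differentiableAt, h.smooth⟩

lemma exists_integral_eq_one (a : ℝ) : ∃ φ, IsTest (Ioi a) φ ∧ ∫ x, φ x = 1 := by
  let f : ContDiffBump (a + 2) := ⟨1 / 2, 1, by norm_num, by norm_num⟩
  refine ⟨f.normed volume, ⟨f.contDiff_normed, f.hasCompactSupport_normed, ?_⟩, f.integral_normed⟩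
  rw [f.tsupport_normed_eq, Real.closedBall_eq_Icc]
  intro x hx
  have h1 : a + 2 - 1 ≤ x := hx.1
  exact mem_Ioi.2 (by linarith)

end IsTest

/-- Du Bois-Reymond's lemma. -/
lemma exists_const_of_integral_deriv_smul_eq_zero {a : ℝ} {w : ℝ → ℂ}
    (hw : LocallyIntegrableOn w (Ioi a))
    (h : ∀ φ, IsTest (Ioi a) φ → ∫ x, deriv φ x • w x = 0) :
    ∃ c, ∀ᵐ x, x ∈ Ioi a → w x = c := by
  obtain ⟨φ₀, hφ₀, h1⟩ := IsTest.exists_integral_eq_one a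
  refine ⟨∫ x, φ₀ x • w x, ?_⟩
  have hl : LocallyIntegrableOn (fun x => w x - ∫ x, φ₀ x • w x) (Ioi a) :=
    hw.sub ((locallyIntegrable_const _).locallyIntegrableOn _)
  have := isOpen_Ioi.ae_eq_zero_of_integral_contDiff_smul_eq_zero hl fun φ k1 k2 k3 => by
    have hφ : IsTest (Ioi a) φ := ⟨k1, k2, k3⟩
    -- Removing the mean with the fixed bump φ₀ turns φ into the derivative of a test function; the
    -- hypothesis then gives ∫ φ (w - ∫ φ₀ w) = 0.
    obtain ⟨η, hη, hη'⟩ := (hφ.sub_const_mul hφ₀ (∫ x, φ x)).exists_primitive (by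
      rw [integral_sub hφ.integrable (hφ₀.integrable.const_mul _), integral_const_mul, h1]
      ring)
    have h2 := h η hη
    rw [hη'] at h2
    simp only [sub_smul, mul_smul] at h2
    rw [integral_sub (hφ.integrable_smul hw) (by exact (hφ₀.integrable_smul hw).smul _), integral_smul] at h2
    simp only [smul_sub]
    rw [integral_sub (hφ.integrable_smul hw) (hφ.integrable.smul_const _),
      integral_smul_const, h2]
  filter_upwards [this] with x hx hxa
  exact sub_eq_zero.1 (hx hxa)

/-- A function with vanishing second distributional derivative on a half-line is affine. -/
lemma exists_affine_of_integral_deriv_deriv_smul_eq_zero {a : ℝ} {w : ℝ → ℂ}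
    (hw : LocallyIntegrableOn w (Ioi a))
    (h : ∀ φ, IsTest (Ioi a) φ → ∫ x, deriv (deriv φ) x • w x = 0) :
    ∃ c d : ℂ, ∀ᵐ x, x ∈ Ioi a → w x = c + d * x := by
  obtain ⟨φ₀, hφ₀, h1⟩ := IsTest.exists_integral_eq_one a
  -- `-k` is the slope: adding `k * x` to `w` gives a function annihilated by derivatives of all
  -- test functions, which is then constant.
  set k : ℂ := ∫ x, deriv φ₀ x • w x with hk
  have hx : LocallyIntegrableOn (fun x : ℝ => k * x) (Ioi a) :=
    (Continuous.locallyIntegrable (by fun_prop)).locallyIntegrableOn _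
  obtain ⟨c, hc⟩ := exists_const_of_integral_deriv_smul_eq_zero (w := fun x => w x + k * x)
    (hw.add hx) fun χ hχ => by
      obtain ⟨η, hη, hη'⟩ := (hχ.sub_const_mul hφ₀ (∫ x, χ x)).exists_primitive (by
        rw [integral_sub hχ.integrable (hφ₀.integrable.const_mul _), integral_const_mul, h1]
        ring)
      have h2 := h η hη
      have e : deriv (deriv η) = fun x => deriv χ x - (∫ x, χ x) * deriv φ₀ x := by
        rw [hη']
        exact funext fun x => ((hχ.hasDerivAt x).sub ((hφ₀.hasDerivAt x).const_mul _)).deriv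
      rw [e] at h2
      simp only [sub_smul, mul_smul] at h2
      rw [integral_sub (hχ.deriv.integrable_smul hw)
        (by exact (hφ₀.deriv.integrable_smul hw).smul _), integral_smul, ← hk] at h2
      have h3 := hχ.integral_deriv_smul (F := fun x : ℝ => k * x) (F' := fun _ => k)
        (.of_hasDerivAt (fun x => by
          simpa using (Complex.ofRealCLM.hasDerivAt (x := x)).const_mul k) continuous_const)
      rw [integral_smul_const] at h3
      simp only [smul_add]
      rw [integral_add (hχ.deriv.integrable_smul hw)
        (hχ.deriv.integrable_smul hx), h3]
      exact h2
  refine ⟨c, -k, ?_⟩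
  filter_upwards [hc] with x hx hxa
  rw [← hx hxa]
  ring

/-- A square integrable weak solution of `u'' = q` on a half-line has a representative with
derivatives in the sense of primitives. -/
lemma exists_isH2_of_weak {a : ℝ} {u q : ℝ → ℂ} (hu : MemLp u 2 (volume.restrict (Ioi a)))
    (hq : MemLp q 2 (volume.restrict (Ioi a)))
    (h : ∀ φ, IsTest (Ioi a) φ → ∫ x, deriv (deriv φ) x • u x = ∫ x, φ x • q x) :
    ∃ v p, IsH2 a v p q ∧ u =ᵐ[volume.restrict (Ioi a)] v := by
  -- Integrability of `q` up to and including the endpoint `a` is what gives the solution a boundary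
  -- value and a boundary derivative there.
  have hqi : ∀ b c, uIcc b c ⊆ Ici a → IntervalIntegrable q volume b c := fun b c hbc => by
    have h1 : MemLp q 2 (volume.restrict (uIcc b c)) := by
      rw [← Measure.restrict_congr_set Ioi_ae_eq_Ici.symm] at hq
      exact hq.mono_measure (Measure.restrict_mono hbc le_rfl)
    have : IsFiniteMeasure (volume.restrict (uIcc b c)) :=
      isFiniteMeasure_restrict.2 isCompact_uIcc.measure_lt_top.ne
    have : IntegrableOn q (uIcc b c) := h1.integrable (by norm_num)
    exact this.intervalIntegrable
  have hprim : ∀ (f : ℝ → ℂ), (∀ b c, uIcc b c ⊆ Ici a → IntervalIntegrable f volume b c) →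
      IsPrimOn (Ici a) (fun x => ∫ t in a..x, f t) f := fun f hf => by
    refine ⟨hf, fun b c hbc => ?_⟩
    have hb : a ≤ b := hbc left_mem_uIcc
    have hc : a ≤ c := hbc right_mem_uIcc
    rw [← intervalIntegral.integral_add_adjacent_intervals
      (hf a b (uIcc_subset_Ici le_rfl hb)) (hf b c hbc)]
    ring
  set P : ℝ → ℂ := fun x => ∫ t in a..x, q t with hP
  have hP1 : IsPrimOn (Ici a) P q := hprim q hqi
  set G : ℝ → ℂ := fun x => ∫ t in a..x, P t with hG
  have hG1 : IsPrimOn (Ici a) G P :=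
    hprim P fun b c hbc => (hP1.continuousOn hbc).intervalIntegrable
  have hloc : ∀ f : ℝ → ℂ, (∀ b c, uIcc b c ⊆ Ici a → ContinuousOn f (uIcc b c)) →
      LocallyIntegrableOn f (Ioi a) := fun f hf => by
    refine ContinuousOn.locallyIntegrableOn (fun x hx => ?_) measurableSet_Ioi
    have h1 := hf a (x + 1) (uIcc_subset_Ici le_rfl (by linarith [mem_Ioi.1 hx]))
    refine (h1.continuousAt ?_).continuousWithinAt
    rw [uIcc_of_le (by linarith [mem_Ioi.1 hx])]
    exact Icc_mem_nhds hx (by linarith)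
  have hGl : LocallyIntegrableOn G (Ioi a) := hloc G fun b c hbc => hG1.continuousOn hbc
  have hul : LocallyIntegrableOn u (Ioi a) := by
    have := hu.locallyIntegrable (by norm_num)
    exact locallyIntegrableOn_of_locallyIntegrable_restrict this
  -- `G` is a twofold primitive of `q`, so u - G has vanishing second distributional derivative.
  obtain ⟨c, d, hcd⟩ := exists_affine_of_integral_deriv_deriv_smul_eq_zero
    (w := fun x => u x - G x) (hul.sub hGl) fun φ hφ => by
      simp only [smul_sub]
      rw [integral_sub (hφ.deriv.deriv.integrable_smul hul)
        (hφ.deriv.deriv.integrable_smul hGl), h φ hφ,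
        hφ.deriv.integral_deriv_smul (hG1.mono Ioi_subset_Ici_self),
        hφ.integral_deriv_smul (hP1.mono Ioi_subset_Ici_self)]
      ring
  have hv : u =ᵐ[volume.restrict (Ioi a)] fun x => G x + (c + d * x) := by
    refine (ae_restrict_iff' measurableSet_Ioi).2 ?_
    filter_upwards [hcd] with x hx hxa
    rw [← hx hxa]; ring
  refine ⟨_, fun x => P x + d, ⟨hG1.add ?_, ?_, (memLp_congr_ae hv).1 hu, hq⟩, hv⟩
  · exact .of_hasDerivAt (fun x => by
      simpa using ((Complex.ofRealCLM.hasDerivAt (x := x)).const_mul d).const_add c)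
      continuous_const
  · have h1 : IsPrimOn (Ici a) (fun _ => d) (fun _ => 0) :=
      .of_hasDerivAt (fun x => hasDerivAt_const x d) continuous_const
    simpa using hP1.add h1

/-! ### Adjoints and closures -/

section Adjoint

variable {E : Type*} [NormedAddCommGroup E] [InnerProductSpace ℂ E] [CompleteSpace E]
  {A : E →ₗ.[ℂ] E}

/-- The condition defining the adjoint is closed in the graph variable, so it passes from the graph
to its closure. -/
lemma adjoint_closure_eq (hd : Dense (A.domain : Set E)) (hc : A.IsClosable) :
    A.closure† = A† := by
  have hd' : Dense (A.closure.domain : Set E) := hd.mono A.le_closure.1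
  refine LinearPMap.eq_of_eq_graph ?_
  rw [LinearPMap.adjoint_graph_eq_graph_adjoint hd, LinearPMap.adjoint_graph_eq_graph_adjoint hd',
    ← hc.graph_closure_eq_closure_graph]
  ext x
  simp only [Submodule.mem_adjoint_iff]
  refine ⟨fun h a b hab => h a b (A.graph.le_topologicalClosure hab), fun h a b hab => ?_⟩
  have hcl : IsClosed {z : E × E | inner ℂ z.2 x.1 - inner ℂ z.1 x.2 = 0} :=
    isClosed_eq (by fun_prop) continuous_const
  exact closure_minimal (s := (A.graph : Set (E × E))) (fun z hz => h z.1 z.2 hz) hcl hab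

/-- This is A†† ⊆ closure of A, in terms of graphs: the double orthogonal complement of the graph is
its closure. The ℓ² product norm provides the Hilbert space structure on E × E. -/
lemma mem_graph_closure_of_adjoint (hd : Dense (A.domain : Set E)) (hc : A.IsClosable) {f g : E}
    (h : ∀ x y : E, (x, y) ∈ A†.graph → inner ℂ x g = inner ℂ y f) :
    (f, g) ∈ A.closure.graph := by
  rw [← hc.graph_closure_eq_closure_graph]
  let e := WithLp.linearEquiv 2 ℂ (E × E)
  let K : Submodule ℂ (WithLp 2 (E × E)) := A.graph.map e.symm.toLinearMap
  have h1 : WithLp.toLp 2 (f, g) ∈ Kᗮᗮ := by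
    rw [Submodule.mem_orthogonal]
    intro w hw
    -- A quarter turn maps the orthogonal complement of the graph of A into the graph of A†.
    have h2 : (w.snd, -w.fst) ∈ A†.graph := by
      rw [LinearPMap.adjoint_graph_eq_graph_adjoint hd, Submodule.mem_adjoint_iff]
      intro a b hab
      have h3 := (Submodule.mem_orthogonal K w).1 hw (e.symm (a, b)) ⟨(a, b), hab, rfl⟩
      rw [WithLp.prod_inner_apply] at h3
      simp only [inner_neg_right, sub_neg_eq_add]
      rw [add_comm]
      exact h3
    have h4 := h _ _ h2
    rw [WithLp.prod_inner_apply]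
    simp only [inner_neg_left] at h4
    change inner ℂ w.fst f + inner ℂ w.snd g = 0
    rw [h4]; ring
  rw [Submodule.orthogonal_orthogonal_eq_closure] at h1
  have h5 : WithLp.toLp 2 (f, g) ∈ closure (WithLp.toLp 2 '' (A.graph : Set (E × E))) := h1
  have hcont : Continuous (fun z : WithLp 2 (E × E) => z.ofLp) := WithLp.prod_continuous_ofLp 2 E E
  have h6 := image_closure_subset_closure_image hcont ⟨_, h5, rfl⟩
  rw [image_image] at h6
  have h7 : (f, g) ∈ closure (A.graph : Set (E × E)) := by simpa using h6
  exact h7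

end Adjoint

/-! ### The islands -/

variable {Λ : ℝ}

lemma closure_leftIsland (Λ : ℝ) : closure (leftIsland Λ : Set ℝ) = Iic (-Λ) := closure_Iio _

lemma closure_rightIsland (Λ : ℝ) : closure (rightIsland Λ : Set ℝ) = Ici Λ := closure_Ioi _

lemma coe_islands (Λ : ℝ) : (islands Λ : Set ℝ) = Iio (-Λ) ∪ Ioi Λ := rfl

lemma closure_islands (Λ : ℝ) : closure (islands Λ : Set ℝ) = Iic (-Λ) ∪ Ici Λ := by
  rw [coe_islands, closure_union, closure_Iio, closure_Ioi]

lemma isRegular_leftIsland (Λ : ℝ) : IsRegular (leftIsland Λ) where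
  ae_eq := by rw [closure_leftIsland]; exact Iio_ae_eq_Iic
  exists_Icc x hx := by
    rw [closure_leftIsland] at hx ⊢
    refine ⟨x - 1, -Λ, by linarith [mem_Iic.1 hx], ⟨by linarith, hx⟩, fun y hy => hy.2, ?_⟩
    rw [← Ici_inter_Iic]
    exact inter_mem (mem_nhdsWithin_of_mem_nhds (Ici_mem_nhds (by linarith))) self_mem_nhdsWithin

lemma isRegular_rightIsland (Λ : ℝ) : IsRegular (rightIsland Λ) where
  ae_eq := by rw [closure_rightIsland]; exact Ioi_ae_eq_Ici
  exists_Icc x hx := by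
    rw [closure_rightIsland] at hx ⊢
    refine ⟨Λ, x + 1, by linarith [mem_Ici.1 hx], ⟨hx, by linarith⟩, fun y hy => hy.1, ?_⟩
    rw [← Ici_inter_Iic]
    exact inter_mem self_mem_nhdsWithin (mem_nhdsWithin_of_mem_nhds (Iic_mem_nhds (by linarith)))

lemma isRegular_islands (hΛ : 0 < Λ) : IsRegular (islands Λ) where
  ae_eq := by
    rw [closure_islands, coe_islands]
    exact Iio_ae_eq_Iic.union Ioi_ae_eq_Ici
  exists_Icc x hx := by
    rw [closure_islands] at hx ⊢
    rcases hx with hx | hx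
    · refine ⟨x - 1, -Λ, by linarith [mem_Iic.1 hx], ⟨by linarith, hx⟩, fun y hy => .inl hy.2, ?_⟩
      rw [mem_nhdsWithin_iff_exists_mem_nhds_inter]
      refine ⟨Icc (x - 1) 0, Icc_mem_nhds (by linarith) (by linarith [mem_Iic.1 hx]), ?_⟩
      rintro y ⟨hy, hy' | hy'⟩
      · exact ⟨hy.1, hy'⟩
      · linarith [mem_Ici.1 hy', hy.2]
    · refine ⟨Λ, x + 1, by linarith [mem_Ici.1 hx], ⟨hx, by linarith⟩, fun y hy => .inr hy.1, ?_⟩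
      rw [mem_nhdsWithin_iff_exists_mem_nhds_inter]
      refine ⟨Icc 0 (x + 1), Icc_mem_nhds (by linarith [mem_Ici.1 hx]) (by linarith), ?_⟩
      rintro y ⟨hy, hy' | hy'⟩
      · linarith [mem_Iic.1 hy', hy.1]
      · exact ⟨hy', hy.2⟩

lemma neg_mem_closure_islands (Λ : ℝ) : -Λ ∈ closure (islands Λ : Set ℝ) := by
  rw [closure_islands]; exact .inl self_mem_Iic

lemma mem_closure_islands (Λ : ℝ) : Λ ∈ closure (islands Λ : Set ℝ) := by
  rw [closure_islands]; exact .inr self_mem_Ici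

/-- A compact interval inside the closure cannot cross the gap: it would contain 0, which is
excluded since Λ > 0. -/
lemma isPrimOn_union (hΛ : 0 < Λ) {f f' : ℝ → ℂ} (hL : IsPrimOn (Iic (-Λ)) f f')
    (hR : IsPrimOn (Ici Λ) f f') : IsPrimOn (closure (islands Λ : Set ℝ)) f f' := by
  have key : ∀ a b, uIcc a b ⊆ closure (islands Λ : Set ℝ) →
      uIcc a b ⊆ Iic (-Λ) ∨ uIcc a b ⊆ Ici Λ := by
    intro a b h
    rw [closure_islands] at h
    have h0 : ∀ x ∈ uIcc a b, x ≤ -Λ ∨ Λ ≤ x := fun x hx => h hx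
    have hm := h0 (min a b) ⟨le_rfl, min_le_max⟩
    have hM := h0 (max a b) ⟨min_le_max, le_rfl⟩
    rcases hM with hM | hM
    · exact .inl fun x hx => hx.2.trans hM
    · rcases hm with hm | hm
      · rcases h0 0 ⟨by linarith, by linarith⟩ with h1 | h1 <;> linarith
      · exact .inr fun x hx => hm.trans hx.1
  refine ⟨fun a b h => ?_, fun a b h => ?_⟩
  · rcases key a b h with k | k
    · exact hL.1 a b k
    · exact hR.1 a b k
  · rcases key a b h with k | k
    · exact hL.2 a b k
    · exact hR.2 a b k

/-- The function that agrees with `f` on `(-∞, 0]` and with `g` on `(0, ∞)`. -/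
noncomputable def glue (f g : ℝ → ℂ) (x : ℝ) : ℂ := (Iic (0 : ℝ)).piecewise f g x

lemma glue_eqOn_left (hΛ : 0 < Λ) (f g : ℝ → ℂ) : EqOn (glue f g) f (Iic (-Λ)) := fun x hx =>
  piecewise_eq_of_mem _ _ _ (mem_Iic.2 (by linarith [mem_Iic.1 hx]))

lemma glue_eqOn_right (hΛ : 0 < Λ) (f g : ℝ → ℂ) : EqOn (glue f g) g (Ici Λ) := fun x hx =>
  piecewise_eq_of_notMem _ _ _ (by rw [mem_Iic, not_le]; linarith [mem_Ici.1 hx])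

lemma isPrimOn_glue (hΛ : 0 < Λ) {f f' g g' : ℝ → ℂ} (hL : IsPrimOn (Iic (-Λ)) f f')
    (hR : IsPrimOn (Ici Λ) g g') :
    IsPrimOn (closure (islands Λ : Set ℝ)) (glue f g) (glue f' g') :=
  isPrimOn_union hΛ (hL.congr (glue_eqOn_left hΛ _ _) (glue_eqOn_left hΛ _ _))
    (hR.congr (glue_eqOn_right hΛ _ _) (glue_eqOn_right hΛ _ _))

lemma ae_islands_iff {P : ℝ → Prop} : (∀ᵐ x ∂volume.restrict (islands Λ : Set ℝ), P x) ↔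
    (∀ᵐ x ∂volume.restrict (leftIsland Λ : Set ℝ), P x) ∧
      ∀ᵐ x ∂volume.restrict (rightIsland Λ : Set ℝ), P x :=
  ae_restrict_union_iff _ _ _

lemma restrict_islands (hΛ : 0 < Λ) : volume.restrict (islands Λ : Set ℝ) =
    volume.restrict (leftIsland Λ : Set ℝ) + volume.restrict (rightIsland Λ : Set ℝ) := by
  refine Measure.restrict_union ?_ measurableSet_Ioi
  rw [Set.disjoint_left]
  intro x h1 h2
  linarith [mem_Iio.1 h1, mem_Ioi.1 h2]

lemma restrict_left_le (Λ : ℝ) : volume.restrict (leftIsland Λ : Set ℝ) ≤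
    volume.restrict (islands Λ : Set ℝ) := Measure.restrict_mono subset_union_left le_rfl

lemma restrict_right_le (Λ : ℝ) : volume.restrict (rightIsland Λ : Set ℝ) ≤
    volume.restrict (islands Λ : Set ℝ) := Measure.restrict_mono subset_union_right le_rfl

lemma memLp_islands (hΛ : 0 < Λ) {f : ℝ → ℂ} (hL : MemLp f 2 (volume.restrict (leftIsland Λ : Set ℝ)))
    (hR : MemLp f 2 (volume.restrict (rightIsland Λ : Set ℝ))) :
    MemLp f 2 (volume.restrict (islands Λ : Set ℝ)) := by
  rw [restrict_islands hΛ]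
  have hm : AEStronglyMeasurable f (volume.restrict (leftIsland Λ : Set ℝ) +
      volume.restrict (rightIsland Λ : Set ℝ)) := aestronglyMeasurable_add_measure_iff.2 ⟨hL.1, hR.1⟩
  rw [memLp_two_iff_integrable_sq_norm hm, integrable_add_measure]
  exact ⟨(memLp_two_iff_integrable_sq_norm hL.1).1 hL, (memLp_two_iff_integrable_sq_norm hR.1).1 hR⟩

lemma memLp_comp_neg {f : ℝ → ℂ} (S : Set ℝ)
    (hf : MemLp f 2 (volume.restrict S)) :
    MemLp (fun x => f (-x)) 2 (volume.restrict (Neg.neg ⁻¹' S)) :=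
  hf.comp_measurePreserving ((Measure.measurePreserving_neg volume).restrict_preimage_emb
    (MeasurableEquiv.neg ℝ).measurableEmbedding S)

lemma neg_preimage_Iio (Λ : ℝ) : (Neg.neg ⁻¹' Iio (-Λ) : Set ℝ) = Ioi Λ := by ext; simp
lemma neg_preimage_Iic (Λ : ℝ) : (Neg.neg ⁻¹' Iic (-Λ) : Set ℝ) = Ici Λ := by ext; simp
lemma neg_preimage_Ici (Λ : ℝ) : (Neg.neg ⁻¹' Ici Λ : Set ℝ) = Iic (-Λ) := by ext; simp

/-! ### Green's formula on the two islands -/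

lemma IsAC2.isH2_right (hΛ : 0 < Λ) {ψ : ℝ → ℂ} (h : IsAC2 (islands Λ) ψ)
    (h2 : MemLp ψ 2 (volume.restrict (islands Λ : Set ℝ))) :
    IsH2 Λ ψ (d1 (islands Λ) ψ) (d2 (islands Λ) ψ) :=
  have hs : Ici Λ ⊆ closure (islands Λ : Set ℝ) := by
    rw [closure_islands]; exact subset_union_right
  ⟨h.isPrimOn_d1.mono hs, ((isRegular_islands hΛ).isPrimOn_d2 h).mono hs,
    h2.mono_measure (restrict_right_le Λ), h.memLp_d2.mono_measure (restrict_right_le Λ)⟩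

lemma IsAC2.isH2_left (hΛ : 0 < Λ) {ψ : ℝ → ℂ} (h : IsAC2 (islands Λ) ψ)
    (h2 : MemLp ψ 2 (volume.restrict (islands Λ : Set ℝ))) :
    IsH2 Λ (fun x => ψ (-x)) (fun x => -d1 (islands Λ) ψ (-x)) (fun x => d2 (islands Λ) ψ (-x)) := by
  have hs : Iic (-Λ) ⊆ closure (islands Λ : Set ℝ) := by
    rw [closure_islands]; exact subset_union_left
  have e1 := (h.isPrimOn_d1.mono hs).comp_neg
  have e2 := (((isRegular_islands hΛ).isPrimOn_d2 h).mono hs).comp_neg.neg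
  have e3 := memLp_comp_neg (Iio (-Λ)) (h2.mono_measure (restrict_left_le Λ))
  have e4 := memLp_comp_neg (Iio (-Λ)) (h.memLp_d2.mono_measure (restrict_left_le Λ))
  rw [neg_preimage_Iic] at e1 e2
  rw [neg_preimage_Iio] at e3 e4
  simp only [neg_neg] at e2
  exact ⟨e1, e2, e3, e4⟩

lemma integral_islands (hΛ : 0 < Λ) {F : ℝ → ℂ}
    (i : Integrable F (volume.restrict (islands Λ : Set ℝ))) :
    ∫ x in (islands Λ : Set ℝ), F x =
      (∫ x in (leftIsland Λ : Set ℝ), F x) + ∫ x in (rightIsland Λ : Set ℝ), F x := by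
  rw [restrict_islands hΛ] at i ⊢
  exact integral_add_measure i.left_of_add_measure i.right_of_add_measure

/-- The boundary form of `-d²/dx²` at the point `x`. -/
noncomputable def boundaryForm (Ω : TopologicalSpace.Opens ℝ) (ψ φ : ℝ → ℂ) (x : ℝ) : ℂ :=
  (starRingEnd ℂ) (ψ x) * d1 Ω φ x - (starRingEnd ℂ) (d1 Ω ψ x) * φ x

/-- The half-line formula is applied on the right island and, after reflection, on the left one. The
signs differ because -Λ is an upper and Λ a lower endpoint. -/
lemma green_islands (hΛ : 0 < Λ) {ψ φ : ℝ → ℂ} (hψ : IsAC2 (islands Λ) ψ)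
    (hφ : IsAC2 (islands Λ) φ) (h2ψ : MemLp ψ 2 (volume.restrict (islands Λ : Set ℝ)))
    (h2φ : MemLp φ 2 (volume.restrict (islands Λ : Set ℝ))) :
    ∫ x in (islands Λ : Set ℝ), ((starRingEnd ℂ) (ψ x) * d2 (islands Λ) φ x -
      (starRingEnd ℂ) (d2 (islands Λ) ψ x) * φ x) =
      boundaryForm (islands Λ) ψ φ (-Λ) - boundaryForm (islands Λ) ψ φ Λ := by
  have i : Integrable (fun x => (starRingEnd ℂ) (ψ x) * d2 (islands Λ) φ x -
      (starRingEnd ℂ) (d2 (islands Λ) ψ x) * φ x) (volume.restrict (islands Λ : Set ℝ)) :=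
    (integrableOn_mul_of_memLp (memLp_conj h2ψ) hφ.memLp_d2).sub
      (integrableOn_mul_of_memLp (memLp_conj hψ.memLp_d2) h2φ)
  have gR := (hψ.isH2_right hΛ h2ψ).conj.green (hφ.isH2_right hΛ h2φ)
  have gL := (hψ.isH2_left hΛ h2ψ).conj.green (hφ.isH2_left hΛ h2φ)
  rw [integral_comp_neg_Ioi Λ (fun x => (starRingEnd ℂ) (ψ x) * d2 (islands Λ) φ x -
      (starRingEnd ℂ) (d2 (islands Λ) ψ x) * φ x), integral_Iic_eq_integral_Iio] at gL
  rw [integral_islands hΛ i]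
  change (∫ x in Iio (-Λ), _) + (∫ x in Ioi Λ, _) = _
  rw [gL, gR, boundaryForm, boundaryForm, map_neg]
  ring

/-- `ψ` is a representative of class `AC²` of `f`. -/
def Represents (f : L2 (islands Λ)) (ψ : ℝ → ℂ) : Prop :=
  IsAC2 (islands Λ) ψ ∧ f =ᵐ[volume.restrict (islands Λ : Set ℝ)] ψ

lemma Represents.memLp {f : L2 (islands Λ)} {ψ : ℝ → ℂ} (h : Represents f ψ) :
    MemLp ψ 2 (volume.restrict (islands Λ : Set ℝ)) := (memLp_congr_ae h.2).1 (Lp.memLp f)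

lemma Represents.mem {f : L2 (islands Λ)} {ψ : ℝ → ℂ} (h : Represents f ψ) :
    f ∈ (maxOperator (islands Λ)).domain := ⟨ψ, h⟩

lemma inner_maxOperator_sub (hΛ : 0 < Λ) (f g : (maxOperator (islands Λ)).domain) {ψ φ : ℝ → ℂ}
    (hf : Represents (f : L2 (islands Λ)) ψ) (hg : Represents (g : L2 (islands Λ)) φ) :
    inner ℂ (maxOperator (islands Λ) f) (g : L2 (islands Λ)) -
      inner ℂ (f : L2 (islands Λ)) (maxOperator (islands Λ) g) =
      boundaryForm (islands Λ) ψ φ (-Λ) - boundaryForm (islands Λ) ψ φ Λ := by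
  rw [← green_islands hΛ hf.1 hg.1 hf.memLp hg.memLp, L2.inner_def, L2.inner_def,
    ← integral_sub (L2.integrable_inner _ _) (L2.integrable_inner _ _)]
  refine integral_congr_ae ?_
  have e1 : maxOperator (islands Λ) f =ᵐ[volume.restrict (islands Λ : Set ℝ)] _ :=
    negSecondDeriv_ae f hf.1 hf.2
  have e2 : maxOperator (islands Λ) g =ᵐ[volume.restrict (islands Λ : Set ℝ)] _ :=
    negSecondDeriv_ae g hg.1 hg.2
  filter_upwards [e1, e2, hf.2, hg.2] with x h1 h2 h3 h4
  rw [h1, h2, h3, h4]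
  simp only [RCLike.inner_apply, map_neg]
  ring

/-! ### The minimal operator and its adjoint -/

variable {Ω : TopologicalSpace.Opens ℝ}

lemma d1_eqOn_deriv (ψ : ℝ → ℂ) : EqOn (d1 Ω ψ) (deriv ψ) (Ω : Set ℝ) := fun _ hx =>
  derivWithin_of_mem_nhds (mem_of_superset (Ω.isOpen.mem_nhds hx) subset_closure)

lemma d2_eqOn_deriv (ψ : ℝ → ℂ) : EqOn (d2 Ω ψ) (deriv (deriv ψ)) (Ω : Set ℝ) :=
  (d1_congr (d1_eqOn_deriv ψ)).trans (d1_eqOn_deriv _)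

lemma eq_zero_of_tsupport_subset {φ : ℝ → ℂ} (h : tsupport φ ⊆ (Ω : Set ℝ)) {p : ℝ}
    (hp : p ∉ (Ω : Set ℝ)) : φ p = 0 ∧ d1 Ω φ p = 0 := by
  have h0 : φ =ᶠ[𝓝 p] fun _ => 0 := notMem_tsupport_iff_eventuallyEq.1 fun k => hp (h k)
  refine ⟨h0.eq_of_nhds, ?_⟩
  rw [d1, (h0.filter_mono nhdsWithin_le_nhds).derivWithin_eq h0.eq_of_nhds]
  simp

lemma neg_notMem_islands (hΛ : 0 < Λ) : -Λ ∉ (islands Λ : Set ℝ) := by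
  rw [coe_islands]
  rintro (h | h)
  · exact lt_irrefl _ (mem_Iio.1 h)
  · linarith [mem_Ioi.1 h]

lemma notMem_islands (hΛ : 0 < Λ) : Λ ∉ (islands Λ : Set ℝ) := by
  rw [coe_islands]
  rintro (h | h)
  · linarith [mem_Iio.1 h]
  · exact lt_irrefl _ (mem_Ioi.1 h)

lemma H00_apply (f : (H00 Λ).domain) (g : (maxOperator (islands Λ)).domain)
    (h : (f : L2 (islands Λ)) = g) : H00 Λ f = maxOperator (islands Λ) g :=
  LinearPMap.domRestrict_apply h

lemma exists_represents_of_mem_H00 (hΛ : 0 < Λ) (f : (H00 Λ).domain) :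
    ∃ φ, Represents (f : L2 (islands Λ)) φ ∧ (φ (-Λ) = 0 ∧ d1 (islands Λ) φ (-Λ) = 0) ∧
      (φ Λ = 0 ∧ d1 (islands Λ) φ Λ = 0) := by
  obtain ⟨φ, h1, h2, h3, h4⟩ := (H00_domain Λ).le f.2
  exact ⟨φ, ⟨isAC2_of_contDiff h1 h2 h3, h4⟩,
    eq_zero_of_tsupport_subset h3 (neg_notMem_islands hΛ),
    eq_zero_of_tsupport_subset h3 (notMem_islands hΛ)⟩

lemma IsTest.exists_mem_testFunctions {φ : ℝ → ℝ} (h : IsTest (Ω : Set ℝ) φ) :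
    ∃ f ∈ testFunctions Ω, f =ᵐ[volume.restrict (Ω : Set ℝ)] fun x => (φ x : ℂ) := by
  have hs : Function.support (fun x => (φ x : ℂ)) = Function.support φ := by
    ext x; simp
  have hc : HasCompactSupport (fun x => (φ x : ℂ)) := by
    have := h.compact
    rw [HasCompactSupport, tsupport] at this ⊢
    rwa [hs]
  have hm : MemLp (fun x => (φ x : ℂ)) 2 (volume.restrict (Ω : Set ℝ)) :=
    ((Complex.continuous_ofReal.comp h.smooth.continuous).memLp_of_hasCompactSupport hc).restrict _
  refine ⟨hm.toLp _, ⟨_, Complex.ofRealCLM.contDiff.comp h.smooth, hc, ?_, hm.coeFn_toLp⟩,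
    hm.coeFn_toLp⟩
  have := h.subset
  rw [tsupport] at this
  change closure (Function.support fun x => (φ x : ℂ)) ⊆ _
  rwa [hs]

lemma inner_eq_integral_smul {φ : ℝ → ℝ} (h : Function.support φ ⊆ (Ω : Set ℝ)) {f : L2 Ω}
    (hf : f =ᵐ[volume.restrict (Ω : Set ℝ)] fun x => (φ x : ℂ)) (y : L2 Ω) :
    inner ℂ f y = ∫ x, φ x • y x := by
  rw [L2.inner_def, ← setIntegral_eq_integral_of_forall_compl_eq_zero (s := (Ω : Set ℝ))
    (f := fun x => φ x • y x) (fun x hx => by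
      have : φ x = 0 := by
        by_contra hne
        exact hx (h hne)
      simp [this])]
  refine integral_congr_ae ?_
  filter_upwards [hf] with x hx
  rw [hx, RCLike.inner_apply, Complex.conj_ofReal, Complex.real_smul, mul_comm]

/-- A vector orthogonal to all test functions, even just the real ones, vanishes almost everywhere.
-/
lemma dense_testFunctions (Ω : TopologicalSpace.Opens ℝ) :
    Dense (testFunctions Ω : Set (L2 Ω)) := by
  rw [Submodule.dense_iff_topologicalClosure_eq_top, Submodule.topologicalClosure_eq_top_iff,
    Submodule.eq_bot_iff]
  intro y hy
  have hl : LocallyIntegrableOn y (Ω : Set ℝ) :=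
    locallyIntegrableOn_of_locallyIntegrable_restrict ((Lp.memLp y).locallyIntegrable (by norm_num))
  have := Ω.isOpen.ae_eq_zero_of_integral_contDiff_smul_eq_zero hl fun φ k1 k2 k3 => by
    obtain ⟨f, hf, hf'⟩ := IsTest.exists_mem_testFunctions (Ω := Ω) ⟨k1, k2, k3⟩
    rw [← inner_eq_integral_smul ((subset_tsupport φ).trans k3) hf']
    exact (Submodule.mem_orthogonal _ _).1 hy f hf
  refine Lp.ext (Filter.EventuallyEq.trans ?_ (Lp.coeFn_zero _ _ _).symm)
  exact (ae_restrict_iff' Ω.isOpen.measurableSet).2 this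

lemma dense_H00_domain (Λ : ℝ) : Dense ((H00 Λ).domain : Set (L2 (islands Λ))) := by
  rw [H00_domain]; exact dense_testFunctions _

/-- Test functions have zero boundary data, so the boundary terms in Green's formula drop out. -/
lemma maxOperator_le_adjoint (hΛ : 0 < Λ) : maxOperator (islands Λ) ≤ (H00 Λ)† := by
  refine LinearPMap.IsFormalAdjoint.le_adjoint (dense_H00_domain Λ) fun f g => ?_
  obtain ⟨φ, hφ, ⟨h1, h2⟩, h3, h4⟩ := exists_represents_of_mem_H00 hΛ f
  obtain ⟨ψ, hψ⟩ := g.2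
  have := inner_maxOperator_sub hΛ ⟨f, hφ.mem⟩ g hφ hψ
  rw [H00_apply f ⟨f, hφ.mem⟩ rfl]
  simp only [boundaryForm, h1, h2, h3, h4, map_zero, zero_mul, sub_zero] at this
  exact sub_eq_zero.1 this

/-- The adjoint relation, tested on real φ, is the weak form of x'' = -`(H00 Λ)† x`. -/
lemma integral_deriv_deriv_smul_of_adjoint {φ : ℝ → ℝ} (h : IsTest (islands Λ : Set ℝ) φ)
    (x : ((H00 Λ)†).domain) :
    ∫ t, deriv (deriv φ) t • (x : L2 (islands Λ)) t = ∫ t, φ t • (-((H00 Λ)† x)) t := by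
  obtain ⟨f, hf, hf'⟩ := h.exists_mem_testFunctions
  have hfd : f ∈ (H00 Λ).domain := by rwa [H00_domain]
  have h1 := (LinearPMap.adjoint_isFormalAdjoint (dense_H00_domain Λ)).symm ⟨f, hfd⟩ x
  have hfm : f ∈ (maxOperator (islands Λ)).domain := hfd.2
  rw [H00_apply ⟨f, hfd⟩ ⟨f, hfm⟩ rfl] at h1
  -- Membership in `testFunctions` supplies some representative χ; it equals φ on the islands by
  -- continuity, and both vanish elsewhere.
  have hAC : IsAC2 (islands Λ) fun x => (φ x : ℂ) := by
    obtain ⟨χ, k1, k2, k3, k4⟩ := hf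
    have e : EqOn χ (fun x => (φ x : ℂ)) (islands Λ : Set ℝ) :=
      Measure.eqOn_open_of_ae_eq (k4.symm.trans hf') (islands Λ).isOpen k1.continuous.continuousOn
        (Complex.continuous_ofReal.comp h.smooth.continuous).continuousOn
    have : χ = fun x => (φ x : ℂ) := by
      funext t
      by_cases ht : t ∈ (islands Λ : Set ℝ)
      · exact e ht
      · rw [image_eq_zero_of_notMem_tsupport fun k => ht (k3 k),
          image_eq_zero_of_notMem_tsupport fun k => ht (h.subset k), Complex.ofReal_zero]
    rw [← this]
    exact isAC2_of_contDiff k1 k2 k3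
  have h2 : maxOperator (islands Λ) ⟨f, hfm⟩ =ᵐ[volume.restrict (islands Λ : Set ℝ)] _ :=
    negSecondDeriv_ae ⟨f, hfm⟩ hAC hf'
  have hder : ∀ {χ : ℝ → ℝ}, IsTest (islands Λ : Set ℝ) χ →
      deriv (fun x => (χ x : ℂ)) = fun x => ((deriv χ x : ℝ) : ℂ) := fun hχ =>
    funext fun t => (hχ.hasDerivAt t).ofReal_comp.deriv
  have h3 : maxOperator (islands Λ) ⟨f, hfm⟩ =ᵐ[volume.restrict (islands Λ : Set ℝ)]
      fun t => ((-deriv (deriv φ) t : ℝ) : ℂ) := by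
    filter_upwards [h2, ae_restrict_mem (islands Λ).isOpen.measurableSet] with t h2 ht
    rw [h2, d2_eqOn_deriv _ ht, hder h, hder h.deriv, Complex.ofReal_neg]
  have hs : Function.support (fun t => -deriv (deriv φ) t) ⊆ (islands Λ : Set ℝ) := by
    intro t ht
    refine h.deriv.deriv.subset (subset_tsupport _ fun k => ht ?_)
    simp [k]
  rw [inner_eq_integral_smul hs h3] at h1
  rw [← inner_eq_integral_smul ((subset_tsupport φ).trans h.subset) hf', inner_neg_right]
  simp only [neg_smul, integral_neg] at h1
  rw [← neg_eq_iff_eq_neg]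
  exact h1

lemma IsTest.comp_neg {S : Set ℝ} {φ : ℝ → ℝ} (h : IsTest S φ) :
    IsTest (Neg.neg ⁻¹' S) (fun x => φ (-x)) := by
  refine ⟨h.smooth.comp contDiff_neg, h.compact.comp_homeomorph (Homeomorph.neg ℝ), ?_⟩
  have := tsupport_comp_eq_preimage φ (Homeomorph.neg ℝ)
  exact this.subset.trans (preimage_mono h.subset)

lemma IsTest.mono {S T : Set ℝ} {φ : ℝ → ℝ} (h : IsTest S φ) (hST : S ⊆ T) : IsTest T φ :=
  ⟨h.smooth, h.compact, h.subset.trans hST⟩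

/-- Weak solutions are regular up to the boundary on each half-line, and the two pieces glue to an
`AC²` representative. -/
lemma adjoint_domain_le (hΛ : 0 < Λ) : ((H00 Λ)†).domain ≤ (maxOperator (islands Λ)).domain := by
  intro f hf
  set q : L2 (islands Λ) := -((H00 Λ)† ⟨f, hf⟩) with hq
  have hfm := Lp.memLp f
  have hqm := Lp.memLp q
  have key : ∀ φ, IsTest (islands Λ : Set ℝ) φ →
      ∫ t, deriv (deriv φ) t • f t = ∫ t, φ t • q t := fun φ hφ =>
    integral_deriv_deriv_smul_of_adjoint hφ ⟨f, hf⟩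
  obtain ⟨v, p, hv, hfv⟩ := exists_isH2_of_weak (hfm.mono_measure (restrict_right_le Λ))
    (hqm.mono_measure (restrict_right_le Λ)) fun φ hφ => key φ (hφ.mono subset_union_right)
  have n1 := memLp_comp_neg (Iio (-Λ)) (hfm.mono_measure (restrict_left_le Λ))
  have n2 := memLp_comp_neg (Iio (-Λ)) (hqm.mono_measure (restrict_left_le Λ))
  rw [neg_preimage_Iio] at n1 n2
  obtain ⟨w, r, hw, hfw⟩ := exists_isH2_of_weak n1 n2 fun φ hφ => by
    have k := hφ.comp_neg
    rw [show (Neg.neg ⁻¹' Ioi Λ : Set ℝ) = Iio (-Λ) by ext; simp] at k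
    have e := key _ (k.mono subset_union_left)
    have d : ∀ χ : ℝ → ℝ, deriv (fun x => χ (-x)) = fun x => -deriv χ (-x) := fun χ =>
      funext fun x => deriv_comp_neg χ x
    have d' : deriv (deriv fun x => φ (-x)) = fun x => deriv (deriv φ) (-x) := by
      rw [d, show (fun x => -deriv φ (-x)) = -fun x => deriv φ (-x) from rfl, deriv.neg', d]
      simp
    rw [d', ← integral_neg_eq_self (fun t => deriv (deriv φ) (-t) • f t),
      ← integral_neg_eq_self (fun t => φ (-t) • q t)] at e
    simpa only [neg_neg] using e
  have w1 := hw.prim.comp_neg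
  have w2 := hw.prim'.comp_neg.neg
  rw [neg_preimage_Ici] at w1 w2
  simp only [neg_neg] at w2
  have hP := isPrimOn_glue hΛ w1 hv.prim
  -- Two reflections restore `q` on the left, so the same `q` serves as second derivative on both
  -- islands.
  have hQ := isPrimOn_union hΛ (w2.congr (glue_eqOn_left hΛ (fun x => -r (-x)) p) fun _ _ => rfl)
    (hv.prim'.congr (glue_eqOn_right hΛ (fun x => -r (-x)) p) fun _ _ => rfl)
  refine ⟨_, (isRegular_islands hΛ).isAC2_of_isPrimOn hP hQ hqm, ?_⟩
  refine ae_islands_iff.2 ⟨?_, ?_⟩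
  · have e : ∀ᵐ x ∂volume.restrict (Iio (-Λ)), f x = w (-x) := by
      have h1 := (ae_restrict_iff' measurableSet_Ioi).1 hfw
      have h2 := (Measure.measurePreserving_neg (volume : Measure ℝ)).quasiMeasurePreserving.ae h1
      refine (ae_restrict_iff' measurableSet_Iio).2 ?_
      filter_upwards [h2] with x hx hxm
      have := hx (mem_Ioi.2 (by linarith [mem_Iio.1 hxm]))
      simpa using this
    filter_upwards [e, ae_restrict_mem measurableSet_Iio] with x hx hxm
    rw [hx, glue_eqOn_left hΛ _ _ (Iio_subset_Iic_self hxm)]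
  · filter_upwards [hfv, ae_restrict_mem measurableSet_Ioi] with x hx hxm
    rw [hx, glue_eqOn_right hΛ _ _ (Ioi_subset_Ici_self hxm)]

lemma adjoint_H00 (hΛ : 0 < Λ) : (H00 Λ)† = maxOperator (islands Λ) :=
  (LinearPMap.eq_of_le_of_domain_eq (maxOperator_le_adjoint hΛ)
    (le_antisymm (maxOperator_le_adjoint hΛ).1 (adjoint_domain_le hΛ))).symm

/-- The operator is a restriction of its adjoint, which is closed. -/
lemma isClosable_H00 (hΛ : 0 < Λ) : (H00 Λ).IsClosable := by
  have h : (maxOperator (islands Λ)).IsClosed := by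
    rw [← adjoint_H00 hΛ]
    exact LinearPMap.adjoint_isClosed (dense_H00_domain Λ)
  exact h.isClosable.leIsClosable LinearPMap.domRestrict_le

lemma adjoint_H0 (hΛ : 0 < Λ) : (H0 Λ)† = maxOperator (islands Λ) :=
  (adjoint_closure_eq (dense_H00_domain Λ) (isClosable_H00 hΛ)).trans (adjoint_H00 hΛ)

/-- Vectors with vanishing boundary data belong to the domain of the minimal operator. -/
lemma mem_H0_domain (hΛ : 0 < Λ) {f : L2 (islands Λ)} {ψ : ℝ → ℂ} (h : Represents f ψ)
    (h1 : ψ (-Λ) = 0) (h2 : d1 (islands Λ) ψ (-Λ) = 0) (h3 : ψ Λ = 0)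
    (h4 : d1 (islands Λ) ψ Λ = 0) : f ∈ (H0 Λ).domain := by
  refine LinearPMap.mem_domain_of_mem_graph (mem_graph_closure_of_adjoint (dense_H00_domain Λ)
    (isClosable_H00 hΛ) (g := maxOperator (islands Λ) ⟨f, h.mem⟩) fun x y hxy => ?_)
  rw [adjoint_H00 hΛ, LinearPMap.mem_graph_iff] at hxy
  obtain ⟨g, hg1, hg2⟩ := hxy
  simp only at hg1 hg2
  subst hg1 hg2
  obtain ⟨φ, hφ⟩ := g.2
  have := inner_maxOperator_sub hΛ g ⟨f, h.mem⟩ hφ h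
  simp only [boundaryForm, h1, h2, h3, h4, mul_zero, sub_zero] at this
  exact (sub_eq_zero.1 this).symm

/-! ### Boundary conditions in terms of boundary data -/

/-- The boundary condition with parameter `α` for the boundary value `v` and the boundary
derivative `d`. -/
def DataCondition (α : OnePoint ℝ) (v d : ℂ) : Prop :=
  (∀ a : ℝ, α = (a : OnePoint ℝ) → d = (a : ℂ) * v) ∧ (α = OnePoint.infty → v = 0)

namespace DataCondition

variable {α β : OnePoint ℝ} {v d v' d' : ℂ} {a : ℝ}

lemma coe_iff : DataCondition (a : OnePoint ℝ) v d ↔ d = a * v := by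
  simp [DataCondition]

lemma infty_iff : DataCondition OnePoint.infty v d ↔ v = 0 := by
  simp [DataCondition]

lemma smul (c : ℂ) (h : DataCondition α v d) : DataCondition α (c * v) (c * d) := by
  induction α using OnePoint.rec with
  | infty => rw [infty_iff] at h ⊢; rw [h, mul_zero]
  | coe a => rw [coe_iff] at h ⊢; rw [h]; ring

/-- The line of admissible pairs is isotropic because α is real or infinite. -/
lemma form_eq_zero (h : DataCondition α v d) (h' : DataCondition α v' d') :
    (starRingEnd ℂ) v * d' - (starRingEnd ℂ) d * v' = 0 := by
  induction α using OnePoint.rec with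
  | infty => rw [infty_iff] at h h'; simp [h, h']
  | coe a =>
    rw [coe_iff] at h h'
    rw [h, h', map_mul, Complex.conj_ofReal]; ring

/-- An isotropic line in ℂ² is its own annihilator for the nondegenerate boundary form, and one
nonzero pair spans it; so testing against that pair suffices. -/
lemma of_form_eq_zero (h : DataCondition α v d) (h0 : v ≠ 0 ∨ d ≠ 0)
    (h' : (starRingEnd ℂ) v' * d - (starRingEnd ℂ) d' * v = 0) : DataCondition α v' d' := by
  induction α using OnePoint.rec with
  | infty =>
    rw [infty_iff] at h ⊢
    subst h
    have hd : d ≠ 0 := by simpa using h0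
    simpa [hd] using h'
  | coe a =>
    rw [coe_iff] at h ⊢
    subst h
    have hv : v ≠ 0 := by
      rintro rfl
      simp at h0
    have h1 : v * ((starRingEnd ℂ) v' * a - (starRingEnd ℂ) d') = 0 := by
      rw [← h']; ring
    have h2 := (mul_eq_zero.1 h1).resolve_left hv
    have h3 := congrArg (starRingEnd ℂ) h2
    simp only [map_sub, map_mul, Complex.conj_conj, Complex.conj_ofReal, map_zero] at h3
    linear_combination -h3

lemma unique (h : DataCondition α v d) (h' : DataCondition β v d) (h0 : v ≠ 0 ∨ d ≠ 0) :
    α = β := by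
  induction α using OnePoint.rec with
  | infty =>
    rw [infty_iff] at h
    subst h
    induction β using OnePoint.rec with
    | infty => rfl
    | coe b =>
      rw [coe_iff, mul_zero] at h'
      simp [h'] at h0
  | coe a =>
    rw [coe_iff] at h
    have hv : v ≠ 0 := by
      rintro rfl
      simp [h] at h0
    induction β using OnePoint.rec with
    | infty => exact absurd (infty_iff.1 h') hv
    | coe b =>
      rw [coe_iff, h] at h'
      rw [Complex.ofReal_inj.1 (mul_right_cancel₀ hv h')]

lemma exists_smul (h : DataCondition α v d) (h0 : v ≠ 0 ∨ d ≠ 0) (h' : DataCondition α v' d') :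
    ∃ c, v' = c * v ∧ d' = c * d := by
  induction α using OnePoint.rec with
  | infty =>
    rw [infty_iff] at h h'
    subst h h'
    have hd : d ≠ 0 := by simpa using h0
    exact ⟨d' / d, by simp, by field_simp⟩
  | coe a =>
    rw [coe_iff] at h h'
    have hv : v ≠ 0 := by
      rintro rfl
      simp [h] at h0
    exact ⟨v' / v, by field_simp, by rw [h, h']; field_simp⟩

end DataCondition

/-- Up to a nonzero factor, the boundary value of `L_+ + γ_L L_-` and of `R_+ + γ_R R_-`. -/
noncomputable def angleValue (θ : ℝ) : ℂ := 1 + Complex.exp (θ * Complex.I)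

/-- Up to a nonzero factor, the boundary derivative of `L_+ + γ_L L_-`. -/
noncomputable def angleDeriv (θ : ℝ) : ℂ :=
  ((1 - Complex.I) + (1 + Complex.I) * Complex.exp (θ * Complex.I)) / (√2 : ℝ)

/-! ### Angles and boundary parameters -/

lemma sqrt_two_ne_zero' : ((√2 : ℝ) : ℂ) ≠ 0 := by simp

/-- This combination eliminates e^{iθ}. Being nonzero and independent of θ, it normalizes the data
within their line; the companion identity then recovers e^{iθ}. -/
lemma angle_identity (θ : ℝ) :
    (√2 : ℝ) * angleDeriv θ - (1 + Complex.I) * angleValue θ = -(2 * Complex.I) := by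
  rw [angleDeriv, angleValue, mul_div_cancel₀ _ sqrt_two_ne_zero']
  ring

lemma angle_identity' (θ : ℝ) : (√2 : ℝ) * angleDeriv θ - (1 - Complex.I) * angleValue θ =
    2 * Complex.I * Complex.exp (θ * Complex.I) := by
  rw [angleDeriv, angleValue, mul_div_cancel₀ _ sqrt_two_ne_zero']
  ring

lemma angle_ne_zero (θ : ℝ) : angleValue θ ≠ 0 ∨ angleDeriv θ ≠ 0 := by
  by_contra h
  push Not at h
  have := angle_identity θ
  simp [h.1, h.2] at this

lemma cos_ne_neg_one {θ : ℝ} (h : θ ∈ Ico 0 (2 * Real.pi)) (hπ : θ ≠ Real.pi) :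
    1 + Real.cos θ ≠ 0 := by
  intro h0
  have h1 : Real.cos (θ - Real.pi) = 1 := by
    rw [Real.cos_sub_pi]; linarith
  have := (Real.cos_eq_one_iff_of_lt_of_lt (by linarith [h.1, Real.pi_pos])
    (by linarith [h.2, Real.pi_pos])).1 h1
  exact hπ (by linarith)

/-- The ratio of derivative to value is (1 - tan(θ/2))/√2, with tan(θ/2) = sin θ/(1 + cos θ); at θ =
π the value vanishes. -/
lemma dataCondition_alphaLeft {θ : ℝ} (h : θ ∈ Ico 0 (2 * Real.pi)) :
    DataCondition (alphaLeft θ) (angleValue θ) (angleDeriv θ) := by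
  rw [alphaLeft]
  split_ifs with hπ
  · rw [DataCondition.infty_iff, angleValue, hπ, Complex.exp_pi_mul_I]
    ring
  · rw [DataCondition.coe_iff]
    have hc := cos_ne_neg_one h hπ
    have hc' : (1 : ℂ) + (Real.cos θ : ℂ) ≠ 0 := by exact_mod_cast hc
    have hsc : ((Real.sin θ : ℝ) : ℂ) ^ 2 + ((Real.cos θ : ℝ) : ℂ) ^ 2 = 1 := by
      exact_mod_cast Real.sin_sq_add_cos_sq θ
    rw [angleDeriv, angleValue, Complex.exp_mul_I, ← Complex.ofReal_cos, ← Complex.ofReal_sin]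
    push_cast [-Complex.ofReal_cos, -Complex.ofReal_sin]
    field_simp [sqrt_two_ne_zero']
    have hI := Complex.I_sq
    grind

lemma alphaRight_eq_map (θ : ℝ) : alphaRight θ = OnePoint.map (fun x : ℝ => -x) (alphaLeft θ) := by
  rw [alphaLeft, alphaRight]
  split_ifs <;> rfl

lemma DataCondition.map_neg {α : OnePoint ℝ} {v d : ℂ} (h : DataCondition α v d) :
    DataCondition (OnePoint.map (fun x : ℝ => -x) α) v (-d) := by
  induction α using OnePoint.rec with
  | infty => rw [OnePoint.map_infty, infty_iff]; exact infty_iff.1 h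
  | coe a => rw [OnePoint.map_some, coe_iff]; rw [coe_iff] at h; rw [h]; push_cast; ring

lemma dataCondition_alphaRight {θ : ℝ} (h : θ ∈ Ico 0 (2 * Real.pi)) :
    DataCondition (alphaRight θ) (angleValue θ) (-angleDeriv θ) := by
  rw [alphaRight_eq_map]
  exact (dataCondition_alphaLeft h).map_neg

lemma exists_angle {z : ℂ} (hz : ‖z‖ = 1) :
    ∃ θ ∈ Ico 0 (2 * Real.pi), Complex.exp (θ * Complex.I) = z := by
  have h := Complex.norm_mul_exp_arg_mul_I z
  rw [hz, Complex.ofReal_one, one_mul] at h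
  rcases le_or_gt 0 z.arg with h0 | h0
  · exact ⟨z.arg, ⟨h0, by linarith [Complex.arg_le_pi z, Real.pi_pos]⟩, h⟩
  · refine ⟨z.arg + 2 * Real.pi, ⟨by linarith [Complex.neg_pi_lt_arg z, Real.pi_pos],
      by linarith⟩, ?_⟩
    rw [← h]
    push_cast
    rw [add_mul, Complex.exp_add, Complex.exp_two_pi_mul_I, mul_one]
    simp [h]

lemma exp_angle_injOn {θ θ' : ℝ} (h : θ ∈ Ico 0 (2 * Real.pi)) (h' : θ' ∈ Ico 0 (2 * Real.pi))
    (e : Complex.exp (θ * Complex.I) = Complex.exp (θ' * Complex.I)) : θ = θ' := by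
  obtain ⟨n, hn⟩ := Complex.exp_eq_exp_iff_exists_int.1 e
  have h1 : θ = θ' + n * (2 * Real.pi) := by
    have h2 : ((θ : ℂ)) = θ' + n * (2 * Real.pi) := by
      apply mul_right_cancel₀ Complex.I_ne_zero
      rw [hn]; ring
    exact_mod_cast h2
  have hp := Real.pi_pos
  have hn0 : n = 0 := by
    have l1 : (n : ℝ) < 1 := by
      by_contra hc
      push Not at hc
      nlinarith [h.2, h'.1]
    have l2 : (-1 : ℝ) < n := by
      by_contra hc
      push Not at hc
      nlinarith [h.1, h'.2]
    have l1' : n < 1 := by exact_mod_cast l1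
    have l2' : -1 < n := by exact_mod_cast l2
    omega
  simpa [hn0] using h1

lemma bijOn_alphaLeft : BijOn alphaLeft (Ico 0 (2 * Real.pi)) univ := by
  refine ⟨mapsTo_univ _ _, fun θ h θ' h' e => ?_, fun α _ => ?_⟩
  · have k := dataCondition_alphaLeft h
    rw [e] at k
    obtain ⟨c, c1, c2⟩ := (dataCondition_alphaLeft h').exists_smul (angle_ne_zero θ') k
    have e1 := angle_identity θ
    have e2 := angle_identity θ'
    have e3 := angle_identity' θ
    have e4 := angle_identity' θ'
    rw [c1, c2] at e1 e3
    -- Equal parameters make the two data proportional; the normalization forces the factor to be 1.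
    have hc : c = 1 := by
      have : (2 * Complex.I) * (c - 1) = 0 := by linear_combination (-1 : ℂ) * e1 + c * e2
      have := (mul_eq_zero.1 this).resolve_left (by simp)
      exact sub_eq_zero.1 this
    subst hc
    refine exp_angle_injOn h h' (mul_left_cancel₀ (a := 2 * Complex.I) (by simp) ?_)
    rw [← e3, ← e4]; ring
  · induction α using OnePoint.rec with
    | infty =>
      exact ⟨Real.pi, ⟨Real.pi_pos.le, by linarith [Real.pi_pos]⟩, by simp [alphaLeft]⟩
    | coe a =>
      -- Solving the condition with parameter `a` for e^{iθ} gives -w̄/w. It has modulus one, and w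
      -- ≠ 0 because its imaginary part is 1.
      set w : ℂ := (1 + Complex.I) - a * (√2 : ℝ) with hw
      have hwre : w = ((1 - a * √2 : ℝ) : ℂ) + Complex.I := by rw [hw]; push_cast; ring
      have hw0 : w ≠ 0 := fun h => by
        have := congrArg Complex.im h
        rw [hwre] at this
        simp at this
      have hconj : (starRingEnd ℂ) w = (1 - Complex.I) - a * (√2 : ℝ) := by
        rw [hw]; simp; ring
      obtain ⟨θ, hθ, he⟩ := exists_angle (z := -((starRingEnd ℂ) w) / w) (by
        rw [norm_div, norm_neg, RCLike.norm_conj, div_self (norm_ne_zero_iff.2 hw0)])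
      refine ⟨θ, hθ, (dataCondition_alphaLeft hθ).unique (DataCondition.coe_iff.2 ?_)
        (angle_ne_zero θ)⟩
      have h1 : Complex.exp (θ * Complex.I) * w = -((starRingEnd ℂ) w) := by
        rw [he]; field_simp
      rw [hconj, hw] at h1
      rw [angleDeriv, angleValue, div_eq_iff sqrt_two_ne_zero']
      linear_combination h1

lemma bijOn_alphaRight : BijOn alphaRight (Ico 0 (2 * Real.pi)) univ := by
  have hinv : Function.Involutive (OnePoint.map fun x : ℝ => -x) := fun α => by
    induction α using OnePoint.rec with
    | infty => rfl
    | coe a => simp [OnePoint.map_some]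
  have := (bijOn_univ.2 hinv.bijective).comp bijOn_alphaLeft
  exact this.congr fun θ _ => (alphaRight_eq_map θ).symm

/-! ### Boundary data of vectors in the maximal domain -/

/-- `f` has an `AC²` representative with the boundary values `vL`, `vR` and the boundary
derivatives `dL`, `dR` at `-Λ` and `Λ`. -/
def HasData (f : L2 (islands Λ)) (vL dL vR dR : ℂ) : Prop :=
  ∃ ψ, Represents f ψ ∧ (ψ (-Λ) = vL ∧ d1 (islands Λ) ψ (-Λ) = dL) ∧
    (ψ Λ = vR ∧ d1 (islands Λ) ψ Λ = dR)

lemma exists_hasData {f : L2 (islands Λ)} (hf : f ∈ (maxOperator (islands Λ)).domain) :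
    ∃ vL dL vR dR, HasData f vL dL vR dR := by
  obtain ⟨ψ, h⟩ := hf
  exact ⟨_, _, _, _, ψ, h, ⟨rfl, rfl⟩, rfl, rfl⟩

/-- Continuity carries the agreement to the boundary points, so boundary data depend on `f` alone.
-/
lemma Represents.eqOn {f : L2 (islands Λ)} {ψ φ : ℝ → ℂ} (h : Represents f ψ)
    (k : Represents f φ) : EqOn ψ φ (closure (islands Λ : Set ℝ)) := by
  have e : EqOn ψ φ (islands Λ : Set ℝ) := Measure.eqOn_open_of_ae_eq (h.2.symm.trans k.2)
    (islands Λ).isOpen (h.1.diff.continuousOn.mono subset_closure)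
    (k.1.diff.continuousOn.mono subset_closure)
  exact e.of_subset_closure h.1.diff.continuousOn k.1.diff.continuousOn subset_closure subset_rfl

namespace HasData

variable {f g : L2 (islands Λ)} {vL dL vR dR vL' dL' vR' dR' : ℂ}

lemma mem (h : HasData f vL dL vR dR) : f ∈ (maxOperator (islands Λ)).domain := by
  obtain ⟨ψ, h, -⟩ := h
  exact h.mem

lemma add (h : HasData f vL dL vR dR) (k : HasData g vL' dL' vR' dR') :
    HasData (f + g) (vL + vL') (dL + dL') (vR + vR') (dR + dR') := by
  obtain ⟨ψ, h, ⟨h1, h2⟩, h3, h4⟩ := h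
  obtain ⟨φ, k, ⟨k1, k2⟩, k3, k4⟩ := k
  subst h1 h2 h3 h4 k1 k2 k3 k4
  exact ⟨ψ + φ, ⟨h.1.add k.1, (Lp.coeFn_add f g).trans (h.2.add k.2)⟩,
    ⟨rfl, h.1.eqOn_d1_add k.1 (neg_mem_closure_islands Λ)⟩,
    rfl, h.1.eqOn_d1_add k.1 (mem_closure_islands Λ)⟩

lemma smul (c : ℂ) (h : HasData f vL dL vR dR) :
    HasData (c • f) (c * vL) (c * dL) (c * vR) (c * dR) := by
  obtain ⟨ψ, h, ⟨h1, h2⟩, h3, h4⟩ := h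
  subst h1 h2 h3 h4
  exact ⟨c • ψ, ⟨h.1.smul c, (Lp.coeFn_smul c f).trans (h.2.const_smul c)⟩,
    ⟨rfl, h.1.eqOn_d1_smul c (neg_mem_closure_islands Λ)⟩,
    rfl, h.1.eqOn_d1_smul c (mem_closure_islands Λ)⟩

lemma inner_sub (hΛ : 0 < Λ) (h : HasData f vL dL vR dR) (k : HasData g vL' dL' vR' dR') :
    inner ℂ (maxOperator (islands Λ) ⟨f, h.mem⟩) g -
      inner ℂ f (maxOperator (islands Λ) ⟨g, k.mem⟩) =
      ((starRingEnd ℂ) vL * dL' - (starRingEnd ℂ) dL * vL') -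
        ((starRingEnd ℂ) vR * dR' - (starRingEnd ℂ) dR * vR') := by
  have hm := h.mem
  have km := k.mem
  obtain ⟨ψ, h, ⟨h1, h2⟩, h3, h4⟩ := h
  obtain ⟨φ, k, ⟨k1, k2⟩, k3, k4⟩ := k
  subst h1 h2 h3 h4 k1 k2 k3 k4
  exact inner_maxOperator_sub hΛ ⟨f, hm⟩ ⟨g, km⟩ h k

lemma mem_H0 (hΛ : 0 < Λ) (h : HasData f 0 0 0 0) : f ∈ (H0 Λ).domain := by
  obtain ⟨ψ, h, ⟨h1, h2⟩, h3, h4⟩ := h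
  exact mem_H0_domain hΛ h h1 h2 h3 h4

end HasData

lemma mem_boundaryDomain_iff {f : L2 (islands Λ)} {αL αR : OnePoint ℝ} {vL dL vR dR : ℂ}
    (h : HasData f vL dL vR dR) :
    f ∈ boundaryDomain (islands Λ) {(-Λ, αL), (Λ, αR)} ↔
      DataCondition αL vL dL ∧ DataCondition αR vR dR := by
  obtain ⟨ψ, h, ⟨h1, h2⟩, h3, h4⟩ := h
  subst h1 h2 h3 h4
  constructor
  · rintro ⟨φ, k1, k2, k3⟩
    have e := h.eqOn ⟨k1, k2⟩
    have e' : ∀ x ∈ closure (islands Λ : Set ℝ), d1 (islands Λ) ψ x = d1 (islands Λ) φ x :=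
      fun x hx => derivWithin_congr e (e hx)
    rw [e (neg_mem_closure_islands Λ), e' _ (neg_mem_closure_islands Λ),
      e (mem_closure_islands Λ), e' _ (mem_closure_islands Λ)]
    exact ⟨k3 (-Λ, αL) (by simp), k3 (Λ, αR) (by simp)⟩
  · rintro ⟨k1, k2⟩
    refine ⟨ψ, h.1, h.2, fun q hq => ?_⟩
    rcases hq with rfl | rfl
    · exact k1
    · exact k2

/-! ### The vectors `L_+ + γ_L L_-` and `R_+ + γ_R R_-` -/

/-- An exponential on each of the two islands. -/
noncomputable def expGlue (A z B w : ℂ) : ℝ → ℂ :=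
  glue (fun x => A * Complex.exp (z * x / (√2 : ℝ))) fun x => B * Complex.exp (w * x / (√2 : ℝ))

lemma isPrimOn_exp (S : Set ℝ) (A z : ℂ) :
    IsPrimOn S (fun x => A * Complex.exp (z * x / (√2 : ℝ)))
      fun x => A * (z / (√2 : ℝ)) * Complex.exp (z * x / (√2 : ℝ)) := by
  refine .of_hasDerivAt (fun x => ?_) (by fun_prop)
  have h1 : HasDerivAt (fun x : ℝ => z * x / (√2 : ℝ)) (z / (√2 : ℝ)) x := by
    simpa using ((Complex.ofRealCLM.hasDerivAt (x := x)).const_mul z).div_const ((√2 : ℝ) : ℂ)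
  exact (h1.cexp.const_mul A).congr_deriv (by ring)

lemma isPrimOn_expGlue (hΛ : 0 < Λ) (A z B w : ℂ) :
    IsPrimOn (closure (islands Λ : Set ℝ)) (expGlue A z B w)
      (expGlue (A * (z / (√2 : ℝ))) z (B * (w / (√2 : ℝ))) w) :=
  isPrimOn_glue hΛ (isPrimOn_exp _ A z) (isPrimOn_exp _ B w)

lemma memLp_expGlue (hΛ : 0 < Λ) (A B : ℂ) {z w : ℂ} (hz : 0 < z.re) (hw : w.re < 0) :
    MemLp (expGlue A z B w) 2 (volume.restrict (islands Λ : Set ℝ)) := by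
  refine memLp_islands hΛ ?_ ?_
  · refine (memLp_congr_ae ?_).1 (memLp_exp_left A z (-Λ) hz _ Measure.restrict_le_self)
    filter_upwards [ae_restrict_mem measurableSet_Iio] with x (hx : x ∈ Iio (-Λ))
    rw [expGlue, glue_eqOn_left hΛ _ _ (Iio_subset_Iic_self hx), indicator_of_mem hx]
  · refine (memLp_congr_ae ?_).1 (memLp_exp_right B w Λ hw _ Measure.restrict_le_self)
    filter_upwards [ae_restrict_mem measurableSet_Ioi] with x (hx : x ∈ Ioi Λ)
    rw [expGlue, glue_eqOn_right hΛ _ _ (Ioi_subset_Ici_self hx), indicator_of_mem hx]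

lemma hasData_of_ae_eq_expGlue (hΛ : 0 < Λ) {A B z w : ℂ} (hz : 0 < z.re) (hw : w.re < 0)
    {f : L2 (islands Λ)}
    (hf : f =ᵐ[volume.restrict (islands Λ : Set ℝ)] expGlue A z B w) :
    HasData f (A * Complex.exp (z * (-Λ : ℝ) / (√2 : ℝ)))
      (A * (z / (√2 : ℝ)) * Complex.exp (z * (-Λ : ℝ) / (√2 : ℝ)))
      (B * Complex.exp (w * Λ / (√2 : ℝ))) (B * (w / (√2 : ℝ)) * Complex.exp (w * Λ / (√2 : ℝ))) := by
  have hΩ := isRegular_islands hΛ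
  have p1 := isPrimOn_expGlue hΛ A z B w
  have p2 := isPrimOn_expGlue hΛ (A * (z / (√2 : ℝ))) z (B * (w / (√2 : ℝ))) w
  refine ⟨_, ⟨hΩ.isAC2_of_isPrimOn p1 p2 (memLp_expGlue hΛ _ _ hz hw), hf⟩, ⟨?_, ?_⟩, ?_, ?_⟩
  · exact glue_eqOn_left hΛ _ _ self_mem_Iic
  · rw [hΩ.eqOn_d1 p1 p2 (neg_mem_closure_islands Λ)]
    exact glue_eqOn_left hΛ _ _ self_mem_Iic
  · exact glue_eqOn_right hΛ _ _ self_mem_Ici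
  · rw [hΩ.eqOn_d1 p1 p2 (mem_closure_islands Λ)]
    exact glue_eqOn_right hΛ _ _ self_mem_Ici

lemma indicator_left_ae_eq (hΛ : 0 < Λ) (A z w : ℂ) :
    ((Iio (-Λ)).indicator fun x : ℝ => A * Complex.exp (z * x / (√2 : ℝ)))
      =ᵐ[volume.restrict (islands Λ : Set ℝ)] expGlue A z 0 w := by
  filter_upwards [ae_restrict_mem (islands Λ).isOpen.measurableSet] with x hx
  rcases hx with hx | hx
  · rw [expGlue, glue_eqOn_left hΛ _ _ (Iio_subset_Iic_self hx), indicator_of_mem hx]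
  · rw [expGlue, glue_eqOn_right hΛ _ _ (Ioi_subset_Ici_self hx), indicator_of_notMem, zero_mul]
    rw [mem_Iio, not_lt]
    linarith [mem_Ioi.1 hx]

lemma indicator_right_ae_eq (hΛ : 0 < Λ) (B z w : ℂ) :
    ((Ioi Λ).indicator fun x : ℝ => B * Complex.exp (w * x / (√2 : ℝ)))
      =ᵐ[volume.restrict (islands Λ : Set ℝ)] expGlue 0 z B w := by
  filter_upwards [ae_restrict_mem (islands Λ).isOpen.measurableSet] with x hx
  rcases hx with hx | hx
  · rw [expGlue, glue_eqOn_left hΛ _ _ (Iio_subset_Iic_self hx), indicator_of_notMem, zero_mul]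
    rw [mem_Ioi, not_lt]
    linarith [mem_Iio.1 hx]
  · rw [expGlue, glue_eqOn_right hΛ _ _ (Ioi_subset_Ici_self hx), indicator_of_mem hx]

lemma normFactor_ne_zero (Λ : ℝ) : normFactor Λ ≠ 0 := by
  rw [normFactor, Complex.ofReal_ne_zero]
  positivity

/-- The common factor of the boundary data of `L_+ + γ_L L_-` and `R_+ + γ_R R_-`. -/
noncomputable def dataFactor (Λ : ℝ) : ℂ :=
  normFactor Λ * Complex.exp ((-1 + Complex.I) * Λ / (√2 : ℝ))

lemma dataFactor_ne_zero (Λ : ℝ) : dataFactor Λ ≠ 0 :=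
  mul_ne_zero (normFactor_ne_zero Λ) (Complex.exp_ne_zero _)

/-- The summand √2 Λ in the phase compensates exactly the difference of the exponents of L₊ and L₋
(or R₊ and R₋) at the boundary. -/
lemma phase_mul_exp (Λ θ : ℝ) :
    phase Λ θ * Complex.exp ((-1 - Complex.I) * Λ / (√2 : ℝ)) =
      Complex.exp (θ * Complex.I) * Complex.exp ((-1 + Complex.I) * Λ / (√2 : ℝ)) := by
  rw [phase, ← Complex.exp_add, ← Complex.exp_add]
  congr 1
  have h : ((√2 : ℝ) : ℂ) ^ 2 = 2 := by
    rw [← Complex.ofReal_pow, Real.sq_sqrt (by norm_num)]; norm_num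
  push_cast
  field_simp [sqrt_two_ne_zero']
  linear_combination (Complex.I * Λ) * h

lemma hasData_left (hΛ : 0 < Λ) (θ : ℝ) :
    HasData (Lplus Λ + phase Λ θ • Lminus Λ) (dataFactor Λ * angleValue θ)
      (dataFactor Λ * angleDeriv θ) 0 0 := by
  -- The exponent -1 on the right island is a dummy: its coefficient is 0, and only its sign is
  -- needed, for decay.
  have h1 := hasData_of_ae_eq_expGlue (A := normFactor Λ) (z := 1 - Complex.I) (B := 0) (w := -1)
    hΛ (by simp) (by simp) (f := Lplus Λ) ((MemLp.coeFn_toLp _).trans (indicator_left_ae_eq hΛ _ _ _))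
  have h2 := hasData_of_ae_eq_expGlue (A := normFactor Λ) (z := 1 + Complex.I) (B := 0) (w := -1)
    hΛ (by simp) (by simp) (f := Lminus Λ) ((MemLp.coeFn_toLp _).trans (indicator_left_ae_eq hΛ _ _ _))
  have e1 : (1 - Complex.I) * (-Λ : ℝ) / (√2 : ℝ) = (-1 + Complex.I) * Λ / (√2 : ℝ) := by
    push_cast; ring
  have e2 : (1 + Complex.I) * (-Λ : ℝ) / (√2 : ℝ) = (-1 - Complex.I) * Λ / (√2 : ℝ) := by
    push_cast; ring
  have h3 := h1.add (h2.smul (phase Λ θ))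
  rw [e1, e2] at h3
  have k := phase_mul_exp Λ θ
  convert h3 using 1
  · rw [dataFactor, angleValue]; linear_combination (-normFactor Λ) * k
  · rw [dataFactor, angleDeriv]
    linear_combination (-normFactor Λ * ((1 + Complex.I) / (√2 : ℝ))) * k
  · ring
  · ring

lemma hasData_right (hΛ : 0 < Λ) (θ : ℝ) :
    HasData (Rplus Λ + phase Λ θ • Rminus Λ) 0 0 (dataFactor Λ * angleValue θ)
      (dataFactor Λ * -angleDeriv θ) := by
  have h1 := hasData_of_ae_eq_expGlue (A := 0) (z := 1) (B := normFactor Λ) (w := -1 + Complex.I)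
    hΛ (by simp) (by simp) (f := Rplus Λ) ((MemLp.coeFn_toLp _).trans (indicator_right_ae_eq hΛ _ _ _))
  have h2 := hasData_of_ae_eq_expGlue (A := 0) (z := 1) (B := normFactor Λ) (w := -1 - Complex.I)
    hΛ (by simp) (by simp) (f := Rminus Λ) ((MemLp.coeFn_toLp _).trans (indicator_right_ae_eq hΛ _ _ _))
  have h3 := h1.add (h2.smul (phase Λ θ))
  have k := phase_mul_exp Λ θ
  convert h3 using 1
  · ring
  · ring
  · rw [dataFactor, angleValue]; linear_combination (-normFactor Λ) * k
  · rw [dataFactor, angleDeriv]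
    linear_combination (-normFactor Λ * ((-1 - Complex.I) / (√2 : ℝ))) * k

/-! ### Self-adjointness -/

lemma Halpha_domain (Λ : ℝ) (αL αR : OnePoint ℝ) :
    (Halpha Λ αL αR).domain = boundaryDomain (islands Λ) {(-Λ, αL), (Λ, αR)} :=
  boundaryOperator_domain _ _

lemma Halpha_apply {αL αR : OnePoint ℝ} (f : (Halpha Λ αL αR).domain)
    (g : (maxOperator (islands Λ)).domain) (h : (f : L2 (islands Λ)) = g) :
    Halpha Λ αL αR f = maxOperator (islands Λ) g := LinearPMap.domRestrict_apply h

lemma Halpha_le (αL αR : OnePoint ℝ) : Halpha Λ αL αR ≤ maxOperator (islands Λ) :=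
  LinearPMap.domRestrict_le

lemma H00_le_Halpha (hΛ : 0 < Λ) (αL αR : OnePoint ℝ) : H00 Λ ≤ Halpha Λ αL αR := by
  refine ⟨fun f hf => ?_, fun f g hfg => ?_⟩
  · rw [Halpha_domain]
    obtain ⟨φ, h1, h2, h3⟩ := exists_represents_of_mem_H00 hΛ ⟨f, hf⟩
    exact (mem_boundaryDomain_iff ⟨φ, h1, h2, h3⟩).2 (by simp [DataCondition])
  · rw [H00_apply f ⟨g, (Halpha_le αL αR).1 g.2⟩ hfg, Halpha_apply g ⟨g, (Halpha_le αL αR).1 g.2⟩ rfl]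

/-- Symmetry is isotropy of the boundary lines. Conversely, an element of the adjoint domain lies in
the maximal domain and its data annihilate both lines, hence belong to them. -/
lemma isSelfAdjoint_Halpha (hΛ : 0 < Λ) (αL αR : OnePoint ℝ) :
    IsSelfAdjoint (Halpha Λ αL αR) := by
  have hle := H00_le_Halpha hΛ αL αR
  have hd : Dense ((Halpha Λ αL αR).domain : Set (L2 (islands Λ))) :=
    (dense_H00_domain Λ).mono hle.1
  have hsymm : Halpha Λ αL αR ≤ (Halpha Λ αL αR)† := by
    refine LinearPMap.IsFormalAdjoint.le_adjoint hd fun f g => ?_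
    have hf := (Halpha_le αL αR).1 f.2
    have hg := (Halpha_le αL αR).1 g.2
    obtain ⟨vL, dL, vR, dR, h⟩ := exists_hasData hf
    obtain ⟨vL', dL', vR', dR', k⟩ := exists_hasData hg
    obtain ⟨h1, h2⟩ := (mem_boundaryDomain_iff h).1 ((Halpha_domain Λ αL αR).le f.2)
    obtain ⟨k1, k2⟩ := (mem_boundaryDomain_iff k).1 ((Halpha_domain Λ αL αR).le g.2)
    have := h.inner_sub hΛ k
    rw [h1.form_eq_zero k1, h2.form_eq_zero k2, sub_zero] at this
    rw [Halpha_apply f ⟨f, hf⟩ rfl, Halpha_apply g ⟨g, hg⟩ rfl]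
    exact sub_eq_zero.1 this
  rw [LinearPMap.isSelfAdjoint_def]
  refine (LinearPMap.eq_of_le_of_domain_eq hsymm (le_antisymm hsymm.1 fun g hg => ?_)).symm
  have hadj := LinearPMap.adjoint_isFormalAdjoint hd
  -- Taking adjoints reverses the inclusion of `H00` in `Halpha`.
  have e : ∀ x : (H00 Λ).domain, inner ℂ ((Halpha Λ αL αR)† ⟨g, hg⟩) (x : L2 (islands Λ)) =
      inner ℂ g (H00 Λ x) := fun x => by
    rw [hadj ⟨g, hg⟩ ⟨x, hle.1 x.2⟩, hle.2 (x := x) (y := ⟨x, hle.1 x.2⟩) rfl]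
  have hg0 : g ∈ ((H00 Λ)†).domain := LinearPMap.mem_adjoint_domain_of_exists g ⟨_, e⟩
  have hgm : g ∈ (maxOperator (islands Λ)).domain := adjoint_domain_le hΛ hg0
  have hval : maxOperator (islands Λ) ⟨g, hgm⟩ = (Halpha Λ αL αR)† ⟨g, hg⟩ := by
    rw [(maxOperator_le_adjoint hΛ).2 (x := ⟨g, hgm⟩) (y := ⟨g, hg0⟩) rfl]
    exact LinearPMap.adjoint_apply_eq (dense_H00_domain Λ) _ e
  obtain ⟨vL, dL, vR, dR, h⟩ := exists_hasData hgm
  have key : ∀ {x : L2 (islands Λ)} {vL' dL' vR' dR' : ℂ}, HasData x vL' dL' vR' dR' →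
      DataCondition αL vL' dL' → DataCondition αR vR' dR' →
      ((starRingEnd ℂ) vL * dL' - (starRingEnd ℂ) dL * vL') -
        ((starRingEnd ℂ) vR * dR' - (starRingEnd ℂ) dR * vR') = 0 := by
    intro x vL' dL' vR' dR' k k1 k2
    have hx : x ∈ (Halpha Λ αL αR).domain := by
      rw [Halpha_domain]; exact (mem_boundaryDomain_iff k).2 ⟨k1, k2⟩
    rw [← h.inner_sub hΛ k, hval, hadj ⟨g, hg⟩ ⟨x, hx⟩, Halpha_apply ⟨x, hx⟩ ⟨x, k.mem⟩ rfl, sub_self]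
  have hz : ∀ α, DataCondition α 0 0 := fun α => by simp [DataCondition]
  have hk := dataFactor_ne_zero Λ
  rw [Halpha_domain]
  refine (mem_boundaryDomain_iff h).2 ⟨?_, ?_⟩
  -- The vector L₊ + γ_L L₋ for the matching angle has nonzero admissible data at -Λ and zero data
  -- at Λ, so it isolates the left condition.
  · obtain ⟨θ, hθ, rfl⟩ := bijOn_alphaLeft.surjOn (mem_univ αL)
    have c := (dataCondition_alphaLeft hθ).smul (dataFactor Λ)
    have := key (hasData_left hΛ θ) c (hz αR)
    refine c.of_form_eq_zero ?_ (by simpa using this)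
    exact (angle_ne_zero θ).imp (mul_ne_zero hk) (mul_ne_zero hk)
  · obtain ⟨θ, hθ, rfl⟩ := bijOn_alphaRight.surjOn (mem_univ αR)
    have c := (dataCondition_alphaRight hθ).smul (dataFactor Λ)
    have := key (hasData_right hΛ θ) (hz αL) c
    refine c.of_form_eq_zero ?_ (by simpa only [mul_zero, sub_zero, zero_sub, neg_eq_zero] using this)
    exact (angle_ne_zero θ).imp (mul_ne_zero hk) fun k => mul_ne_zero hk (neg_ne_zero.2 k)

/-- A self-adjoint operator is closed, so it contains the closure of each of its restrictions. -/
lemma H0_le_Halpha (hΛ : 0 < Λ) (αL αR : OnePoint ℝ) : H0 Λ ≤ Halpha Λ αL αR := by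
  have hc := (isSelfAdjoint_Halpha hΛ αL αR).isClosed
  have h := hc.isClosable.closure_mono (H00_le_Halpha hΛ αL αR)
  have e : (Halpha Λ αL αR).closure = Halpha Λ αL αR := by
    refine LinearPMap.eq_of_eq_graph (SetLike.coe_injective ?_)
    rw [← hc.isClosable.graph_closure_eq_closure_graph, Submodule.topologicalClosure_coe]
    exact IsClosed.closure_eq hc
  rwa [e] at h

/-! ### The operators `H_γ` -/

lemma gammaDomain_eq (hΛ : 0 < Λ) {θL θR : ℝ} (hL : θL ∈ Ico 0 (2 * Real.pi))
    (hR : θR ∈ Ico 0 (2 * Real.pi)) :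
    gammaDomain Λ (phase Λ θL) (phase Λ θR) =
      boundaryDomain (islands Λ) {(-Λ, alphaLeft θL), (Λ, alphaRight θR)} := by
  have cL := (dataCondition_alphaLeft hL).smul (dataFactor Λ)
  have cR := (dataCondition_alphaRight hR).smul (dataFactor Λ)
  have hz : ∀ α, DataCondition α 0 0 := fun α => by simp [DataCondition]
  have hk := dataFactor_ne_zero Λ
  refine le_antisymm ?_ fun f hf => ?_
  · rintro f ⟨ψ₀, h₀, a, b, rfl⟩
    have h1 := (H0_le_Halpha hΛ (alphaLeft θL) (alphaRight θR)).1 h₀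
    rw [Halpha_domain] at h1
    exact add_mem (add_mem h1
      (Submodule.smul_mem _ a ((mem_boundaryDomain_iff (hasData_left hΛ θL)).2 ⟨cL, hz _⟩)))
      (Submodule.smul_mem _ b ((mem_boundaryDomain_iff (hasData_right hΛ θR)).2 ⟨hz _, cR⟩))
  · obtain ⟨vL, dL, vR, dR, h⟩ := exists_hasData ((Halpha_le _ _).1 ((Halpha_domain _ _ _).ge hf))
    obtain ⟨k1, k2⟩ := (mem_boundaryDomain_iff h).1 hf
    obtain ⟨a, a1, a2⟩ := cL.exists_smul
      ((angle_ne_zero θL).imp (mul_ne_zero hk) (mul_ne_zero hk)) k1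
    obtain ⟨b, b1, b2⟩ := cR.exists_smul
      ((angle_ne_zero θR).imp (mul_ne_zero hk) fun k => mul_ne_zero hk (neg_ne_zero.2 k)) k2
    -- The factors `a` and `b` are chosen to cancel the data at the two ends; the remainder then
    -- lies in D(H₀).
    have h0 := (h.add ((hasData_left hΛ θL).smul (-a))).add ((hasData_right hΛ θR).smul (-b))
    refine ⟨_, HasData.mem_H0 hΛ (f := f + (-a) • (Lplus Λ + phase Λ θL • Lminus Λ) +
      (-b) • (Rplus Λ + phase Λ θR • Rminus Λ)) ?_, a, b, by module⟩
    convert h0 using 1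
    · rw [a1]; ring
    · rw [a2]; ring
    · rw [b1]; ring
    · rw [b2]; ring

lemma Hgamma_eq_Halpha (hΛ : 0 < Λ) {θL θR : ℝ} (hL : θL ∈ Ico 0 (2 * Real.pi))
    (hR : θR ∈ Ico 0 (2 * Real.pi)) :
    Hgamma Λ (phase Λ θL) (phase Λ θR) = Halpha Λ (alphaLeft θL) (alphaRight θR) := by
  rw [Hgamma, gammaDomain_eq hΛ hL hR]
  rfl

/-- The vectors L₊ + γ_L L₋ and R₊ + γ_R R₋ lie in the common domain, and their nonzero data
determine the parameters. -/
lemma Halpha_eq_iff (hΛ : 0 < Λ) {θL θR : ℝ} (hL : θL ∈ Ico 0 (2 * Real.pi))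
    (hR : θR ∈ Ico 0 (2 * Real.pi)) (αL αR : OnePoint ℝ) :
    Halpha Λ αL αR = Hgamma Λ (phase Λ θL) (phase Λ θR) ↔
      αL = alphaLeft θL ∧ αR = alphaRight θR := by
  rw [Hgamma_eq_Halpha hΛ hL hR]
  refine ⟨fun h => ?_, fun h => by rw [h.1, h.2]⟩
  have cL := (dataCondition_alphaLeft hL).smul (dataFactor Λ)
  have cR := (dataCondition_alphaRight hR).smul (dataFactor Λ)
  have hz : ∀ α, DataCondition α 0 0 := fun α => by simp [DataCondition]
  have hk := dataFactor_ne_zero Λ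
  have hd : boundaryDomain (islands Λ) {(-Λ, αL), (Λ, αR)} =
      boundaryDomain (islands Λ) {(-Λ, alphaLeft θL), (Λ, alphaRight θR)} := by
    rw [← Halpha_domain, ← Halpha_domain, h]
  constructor
  · have := (mem_boundaryDomain_iff (hasData_left hΛ θL)).2 ⟨cL, hz (alphaRight θR)⟩
    rw [← hd, mem_boundaryDomain_iff (hasData_left hΛ θL)] at this
    exact this.1.unique cL ((angle_ne_zero θL).imp (mul_ne_zero hk) (mul_ne_zero hk))
  · have := (mem_boundaryDomain_iff (hasData_right hΛ θR)).2 ⟨hz (alphaLeft θL), cR⟩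
    rw [← hd, mem_boundaryDomain_iff (hasData_right hΛ θR)] at this
    exact this.2.unique cR
      ((angle_ne_zero θR).imp (mul_ne_zero hk) fun k => mul_ne_zero hk (neg_ne_zero.2 k))

/-! ### The decomposition into the two islands -/

/-- The restriction of square integrable functions to a smaller measure. -/
noncomputable def restrictLp {μ ν : Measure ℝ} (h : ν ≤ μ) : Lp ℂ 2 μ →ₗ[ℂ] Lp ℂ 2 ν where
  toFun f := ((Lp.memLp f).mono_measure h).toLp f
  map_add' f g := by
    apply Lp.ext
    have hac := Measure.absolutelyContinuous_of_le h
    filter_upwards [((Lp.memLp (f + g)).mono_measure h).coeFn_toLp,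
      ((Lp.memLp f).mono_measure h).coeFn_toLp, ((Lp.memLp g).mono_measure h).coeFn_toLp,
      hac.ae_le (Lp.coeFn_add f g), Lp.coeFn_add (((Lp.memLp f).mono_measure h).toLp f)
        (((Lp.memLp g).mono_measure h).toLp g)] with x h1 h2 h3 h4 h5
    rw [h1, h5, h4, Pi.add_apply, Pi.add_apply, h2, h3]
  map_smul' c f := by
    apply Lp.ext
    have hac := Measure.absolutelyContinuous_of_le h
    filter_upwards [((Lp.memLp (c • f)).mono_measure h).coeFn_toLp,
      ((Lp.memLp f).mono_measure h).coeFn_toLp,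
      hac.ae_le (Lp.coeFn_smul c f), Lp.coeFn_smul c (((Lp.memLp f).mono_measure h).toLp f)]
      with x h1 h2 h4 h5
    rw [RingHom.id_apply, h1, h5, h4, Pi.smul_apply, Pi.smul_apply, h2]

lemma restrictLp_ae_eq {μ ν : Measure ℝ} (h : ν ≤ μ) (f : Lp ℂ 2 μ) : restrictLp h f =ᵐ[ν] f :=
  ((Lp.memLp f).mono_measure h).coeFn_toLp

/-- `ψ ↦ (ψ|Ω_L, ψ|Ω_R)` as a linear map. -/
noncomputable def splitLinear (Λ : ℝ) :
    L2 (islands Λ) →ₗ[ℂ] WithLp 2 (L2 (leftIsland Λ) × L2 (rightIsland Λ)) :=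
  (WithLp.linearEquiv 2 ℂ (L2 (leftIsland Λ) × L2 (rightIsland Λ))).symm.toLinearMap ∘ₗ
    (restrictLp (restrict_left_le Λ)).prod (restrictLp (restrict_right_le Λ))

lemma splitLinear_fst (f : L2 (islands Λ)) :
    (splitLinear Λ f).fst = restrictLp (restrict_left_le Λ) f := rfl

lemma splitLinear_snd (f : L2 (islands Λ)) :
    (splitLinear Λ f).snd = restrictLp (restrict_right_le Λ) f := rfl

lemma inner_splitLinear (hΛ : 0 < Λ) (f g : L2 (islands Λ)) :
    inner ℂ (splitLinear Λ f) (splitLinear Λ g) = inner ℂ f g := by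
  have i := L2.integrable_inner (𝕜 := ℂ) f g
  rw [WithLp.prod_inner_apply]
  change inner ℂ (splitLinear Λ f).fst (splitLinear Λ g).fst +
    inner ℂ (splitLinear Λ f).snd (splitLinear Λ g).snd = _
  rw [splitLinear_fst, splitLinear_fst, splitLinear_snd, splitLinear_snd, L2.inner_def,
    L2.inner_def, L2.inner_def, integral_islands hΛ i]
  congr 1
  · refine integral_congr_ae ?_
    filter_upwards [restrictLp_ae_eq (restrict_left_le Λ) f,
      restrictLp_ae_eq (restrict_left_le Λ) g] with x h1 h2
    rw [h1, h2]
  · refine integral_congr_ae ?_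
    filter_upwards [restrictLp_ae_eq (restrict_right_le Λ) f,
      restrictLp_ae_eq (restrict_right_le Λ) g] with x h1 h2
    rw [h1, h2]

lemma ae_glue_left (hΛ : 0 < Λ) (f g : ℝ → ℂ) :
    glue f g =ᵐ[volume.restrict (leftIsland Λ : Set ℝ)] f := by
  filter_upwards [ae_restrict_mem measurableSet_Iio] with x (hx : x ∈ Iio (-Λ))
  exact glue_eqOn_left hΛ _ _ (Iio_subset_Iic_self hx)

lemma ae_glue_right (hΛ : 0 < Λ) (f g : ℝ → ℂ) :
    glue f g =ᵐ[volume.restrict (rightIsland Λ : Set ℝ)] g := by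
  filter_upwards [ae_restrict_mem measurableSet_Ioi] with x (hx : x ∈ Ioi Λ)
  exact glue_eqOn_right hΛ _ _ (Ioi_subset_Ici_self hx)

lemma memLp_glue (hΛ : 0 < Λ) {f g : ℝ → ℂ}
    (hf : MemLp f 2 (volume.restrict (leftIsland Λ : Set ℝ)))
    (hg : MemLp g 2 (volume.restrict (rightIsland Λ : Set ℝ))) :
    MemLp (glue f g) 2 (volume.restrict (islands Λ : Set ℝ)) :=
  memLp_islands hΛ ((memLp_congr_ae (ae_glue_left hΛ f g)).2 hf)
    ((memLp_congr_ae (ae_glue_right hΛ f g)).2 hg)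

lemma splitLinear_surjective (hΛ : 0 < Λ) : Function.Surjective (splitLinear Λ) := by
  intro p
  have hm := memLp_glue hΛ (Lp.memLp p.fst) (Lp.memLp p.snd)
  have h1 := ae_islands_iff.1 hm.coeFn_toLp
  refine ⟨hm.toLp _, WithLp.ofLp_injective 2 (Prod.ext (Lp.ext ?_) (Lp.ext ?_))⟩
  · exact ((restrictLp_ae_eq (restrict_left_le Λ) _).trans h1.1).trans (ae_glue_left hΛ _ _)
  · exact ((restrictLp_ae_eq (restrict_right_le Λ) _).trans h1.2).trans (ae_glue_right hΛ _ _)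

/-- The unitary map `ψ ↦ (ψ|Ω_L, ψ|Ω_R)`. -/
noncomputable def split (hΛ : 0 < Λ) :
    L2 (islands Λ) ≃ₗᵢ[ℂ] WithLp 2 (L2 (leftIsland Λ) × L2 (rightIsland Λ)) :=
  .ofSurjective ((splitLinear Λ).isometryOfInner (inner_splitLinear hΛ)) (splitLinear_surjective hΛ)

lemma split_fst_ae_eq (hΛ : 0 < Λ) (f : L2 (islands Λ)) :
    (split hΛ f).fst =ᵐ[volume.restrict (leftIsland Λ : Set ℝ)] f :=
  restrictLp_ae_eq (restrict_left_le Λ) f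

lemma split_snd_ae_eq (hΛ : 0 < Λ) (f : L2 (islands Λ)) :
    (split hΛ f).snd =ᵐ[volume.restrict (rightIsland Λ : Set ℝ)] f :=
  restrictLp_ae_eq (restrict_right_le Λ) f

/-- One representative witnesses the domain, the boundary conditions and the value together, which
suits the formulation of `Intertwines` by graphs. -/
lemma mem_graph_boundaryOperator_iff {Ω : TopologicalSpace.Opens ℝ} {bc : Set (ℝ × OnePoint ℝ)}
    {f g : L2 Ω} : (f, g) ∈ (boundaryOperator Ω bc).graph ↔
      ∃ ψ : ℝ → ℂ, IsAC2 Ω ψ ∧ f =ᵐ[volume.restrict (Ω : Set ℝ)] ψ ∧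
        (∀ q ∈ bc, BoundaryCondition Ω q.1 q.2 ψ) ∧
        g =ᵐ[volume.restrict (Ω : Set ℝ)] fun x => -d2 Ω ψ x := by
  rw [LinearPMap.mem_graph_iff]
  constructor
  · rintro ⟨y, rfl, rfl⟩
    obtain ⟨ψ, h1, h2, h3⟩ := (boundaryOperator_domain Ω bc).le y.2
    have e : boundaryOperator Ω bc y = maxOperator Ω ⟨(y : L2 Ω), ψ, h1, h2⟩ :=
      LinearPMap.domRestrict_apply rfl
    refine ⟨ψ, h1, h2, h3, ?_⟩
    rw [e]
    exact negSecondDeriv_ae ⟨(y : L2 Ω), ψ, h1, h2⟩ h1 h2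
  · rintro ⟨ψ, h1, h2, h3, h4⟩
    have hy : f ∈ (boundaryOperator Ω bc).domain := by
      rw [boundaryOperator_domain]; exact ⟨ψ, h1, h2, h3⟩
    have e : boundaryOperator Ω bc ⟨f, hy⟩ = maxOperator Ω ⟨f, ψ, h1, h2⟩ :=
      LinearPMap.domRestrict_apply rfl
    refine ⟨⟨f, hy⟩, rfl, ?_⟩
    rw [e]
    exact Lp.ext ((negSecondDeriv_ae ⟨f, ψ, h1, h2⟩ h1 h2).trans h4.symm)

lemma mem_graph_directSum_iff {E F : Type*} [NormedAddCommGroup E] [InnerProductSpace ℂ E]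
    [NormedAddCommGroup F] [InnerProductSpace ℂ F] {A : E →ₗ.[ℂ] E} {B : F →ₗ.[ℂ] F}
    {p q : WithLp 2 (E × F)} : (p, q) ∈ (directSum A B).graph ↔
      (p.fst, q.fst) ∈ A.graph ∧ (p.snd, q.snd) ∈ B.graph := by
  simp only [LinearPMap.mem_graph_iff]
  constructor
  · rintro ⟨y, rfl, rfl⟩
    exact ⟨⟨⟨_, y.2.1⟩, rfl, rfl⟩, ⟨_, y.2.2⟩, rfl, rfl⟩
  · rintro ⟨⟨a, ha, ha'⟩, b, hb, hb'⟩
    have hp : p ∈ (directSum A B).domain := ⟨ha ▸ a.2, hb ▸ b.2⟩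
    refine ⟨⟨p, hp⟩, rfl, WithLp.ofLp_injective 2 (Prod.ext ?_ ?_)⟩
    · exact (congrArg A (Subtype.ext ha.symm)).trans ha'
    · exact (congrArg B (Subtype.ext hb.symm)).trans hb'

lemma BoundaryCondition.congr {Ω Ω' : TopologicalSpace.Opens ℝ} {p : ℝ} {α : OnePoint ℝ}
    {ψ φ : ℝ → ℂ} (h : BoundaryCondition Ω p α ψ) (h1 : φ p = ψ p) (h2 : d1 Ω' φ p = d1 Ω ψ p) :
    BoundaryCondition Ω' p α φ := by
  rw [BoundaryCondition, h1, h2]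
  exact h

/-- Each condition involves one island only. Derivatives relative to the closures of different sets
are compared through the common primitives, by `IsRegular.eqOn_d1` and `IsRegular.d2_ae_eq`. -/
lemma split_intertwines (hΛ : 0 < Λ) (αL αR : OnePoint ℝ) :
    Intertwines (split hΛ) (Halpha Λ αL αR)
      (directSum (HalphaLeft Λ αL) (HalphaRight Λ αR)) := by
  have hI := isRegular_islands hΛ
  have hL := isRegular_leftIsland Λ
  have hR := isRegular_rightIsland Λ
  intro f g
  rw [mem_graph_directSum_iff, Halpha, HalphaLeft, HalphaRight, mem_graph_boundaryOperator_iff,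
    mem_graph_boundaryOperator_iff, mem_graph_boundaryOperator_iff]
  constructor
  · rintro ⟨ψ, h1, h2, h3, h4⟩
    have p1 := h1.isPrimOn_d1
    have p2 := hI.isPrimOn_d2 h1
    have h4' := ae_islands_iff.1 h4
    have h2' := ae_islands_iff.1 h2
    constructor
    · have hs : closure (leftIsland Λ : Set ℝ) ⊆ closure (islands Λ : Set ℝ) :=
        closure_mono subset_union_left
      have q1 := p1.mono hs
      have q2 := p2.mono hs
      refine ⟨ψ, hL.isAC2_of_isPrimOn q1 q2 (h1.memLp_d2.mono_measure (restrict_left_le Λ)),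
        (split_fst_ae_eq hΛ f).trans h2'.1, ?_, ?_⟩
      · rintro q rfl
        refine (h3 (-Λ, αL) (by simp)).congr rfl (hL.eqOn_d1 q1 q2 ?_)
        rw [closure_leftIsland]; exact self_mem_Iic
      · filter_upwards [split_fst_ae_eq hΛ g, h4'.1, hL.d2_ae_eq q1 q2] with x k1 k2 k3
        rw [k1, k2, k3]
    · have hs : closure (rightIsland Λ : Set ℝ) ⊆ closure (islands Λ : Set ℝ) :=
        closure_mono subset_union_right
      have q1 := p1.mono hs
      have q2 := p2.mono hs
      refine ⟨ψ, hR.isAC2_of_isPrimOn q1 q2 (h1.memLp_d2.mono_measure (restrict_right_le Λ)),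
        (split_snd_ae_eq hΛ f).trans h2'.2, ?_, ?_⟩
      · rintro q rfl
        refine (h3 (Λ, αR) (by simp)).congr rfl (hR.eqOn_d1 q1 q2 ?_)
        rw [closure_rightIsland]; exact self_mem_Ici
      · filter_upwards [split_snd_ae_eq hΛ g, h4'.2, hR.d2_ae_eq q1 q2] with x k1 k2 k3
        rw [k1, k2, k3]
  · rintro ⟨⟨ψ, h1, h2, h3, h4⟩, φ, k1, k2, k3, k4⟩
    have a1 := h1.isPrimOn_d1
    have a2 := hL.isPrimOn_d2 h1
    have b1 := k1.isPrimOn_d1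
    have b2 := hR.isPrimOn_d2 k1
    rw [closure_leftIsland] at a1 a2
    rw [closure_rightIsland] at b1 b2
    have q1 := isPrimOn_glue hΛ a1 b1
    have q2 := isPrimOn_glue hΛ a2 b2
    have e := hI.eqOn_d1 q1 q2
    have e2 := ae_islands_iff.1 (hI.d2_ae_eq q1 q2)
    refine ⟨_, hI.isAC2_of_isPrimOn q1 q2 (memLp_glue hΛ h1.memLp_d2 k1.memLp_d2),
      ae_islands_iff.2 ⟨?_, ?_⟩, ?_, ae_islands_iff.2 ⟨?_, ?_⟩⟩
    · exact ((split_fst_ae_eq hΛ f).symm.trans h2).trans (ae_glue_left hΛ _ _).symm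
    · exact ((split_snd_ae_eq hΛ f).symm.trans k2).trans (ae_glue_right hΛ _ _).symm
    · rintro q (rfl | rfl)
      · refine (h3 (-Λ, αL) rfl).congr (glue_eqOn_left hΛ _ _ self_mem_Iic) ?_
        exact (e (neg_mem_closure_islands Λ)).trans (glue_eqOn_left hΛ _ _ self_mem_Iic)
      · refine (k3 (Λ, αR) rfl).congr (glue_eqOn_right hΛ _ _ self_mem_Ici) ?_
        exact (e (mem_closure_islands Λ)).trans (glue_eqOn_right hΛ _ _ self_mem_Ici)
    · filter_upwards [split_fst_ae_eq hΛ g, h4, e2.1, ae_glue_left hΛ (d2 (leftIsland Λ) ψ)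
        (d2 (rightIsland Λ) φ)] with x m1 m2 m3 m4
      rw [← m1, m2, m3, m4]
    · filter_upwards [split_snd_ae_eq hΛ g, k4, e2.2, ae_glue_right hΛ (d2 (leftIsland Λ) ψ)
        (d2 (rightIsland Λ) φ)] with x m1 m2 m3 m4
      rw [← m1, m2, m3, m4]

end Junction

theorem mainTheorem1 (Λ : ℝ) (hΛ : 0 < Λ) :
    -- the adjoint of `H₀` is `-d²/dx²` on `AC²`
    (Junction.H0 Λ)† = Junction.maxOperator (Junction.islands Λ) ∧
    -- (i)
    (∀ θL ∈ Ico 0 (2 * Real.pi), ∀ θR ∈ Ico 0 (2 * Real.pi),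
      (Junction.Hgamma Λ (Junction.phase Λ θL) (Junction.phase Λ θR)).domain =
        Junction.gammaDomain Λ (Junction.phase Λ θL) (Junction.phase Λ θR) ∧
      Junction.IsSelfAdjointExtension (Junction.H0 Λ)
        (Junction.Hgamma Λ (Junction.phase Λ θL) (Junction.phase Λ θR))) ∧
    -- (ii)
    (∀ αL αR : OnePoint ℝ,
      Junction.IsSelfAdjointExtension (Junction.H0 Λ) (Junction.Halpha Λ αL αR)) ∧
    -- (iii), the correspondence
    (∀ θL ∈ Ico 0 (2 * Real.pi), ∀ θR ∈ Ico 0 (2 * Real.pi), ∀ αL αR : OnePoint ℝ,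
      Junction.Halpha Λ αL αR =
          Junction.Hgamma Λ (Junction.phase Λ θL) (Junction.phase Λ θR) ↔
        αL = Junction.alphaLeft θL ∧ αR = Junction.alphaRight θR) ∧
    BijOn (fun θ : ℝ × ℝ => (Junction.alphaLeft θ.1, Junction.alphaRight θ.2))
      (Ico 0 (2 * Real.pi) ×ˢ Ico 0 (2 * Real.pi)) univ ∧
    -- (iii), the decomposition, through the unitary map `ψ ↦ (ψ|Ω_L, ψ|Ω_R)`
    ∃ U : Junction.L2 (Junction.islands Λ) ≃ₗᵢ[ℂ]
        WithLp 2 (Junction.L2 (Junction.leftIsland Λ) × Junction.L2 (Junction.rightIsland Λ)),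
      (∀ f, (U f).fst =ᵐ[volume.restrict (Junction.leftIsland Λ : Set ℝ)] f ∧
        (U f).snd =ᵐ[volume.restrict (Junction.rightIsland Λ : Set ℝ)] f) ∧
      ∀ αL αR : OnePoint ℝ, Junction.Intertwines U (Junction.Halpha Λ αL αR)
        (Junction.directSum (Junction.HalphaLeft Λ αL) (Junction.HalphaRight Λ αR)) := by
  refine ⟨Junction.adjoint_H0 hΛ, fun θL hL θR hR => ?_, fun αL αR => ?_,
    fun θL hL θR hR αL αR => Junction.Halpha_eq_iff hΛ hL hR αL αR,
    ?_, Junction.split hΛ, fun f => ?_, Junction.split_intertwines hΛ⟩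
  · rw [Junction.Hgamma_eq_Halpha hΛ hL hR, Junction.gammaDomain_eq hΛ hL hR]
    exact ⟨Junction.Halpha_domain _ _ _, Junction.H0_le_Halpha hΛ _ _,
      Junction.isSelfAdjoint_Halpha hΛ _ _⟩
  · exact ⟨Junction.H0_le_Halpha hΛ _ _, Junction.isSelfAdjoint_Halpha hΛ _ _⟩
  · rw [← univ_prod_univ]
    exact Junction.bijOn_alphaLeft.prodMap Junction.bijOn_alphaRight
  · exact ⟨Junction.split_fst_ae_eq hΛ f, Junction.split_snd_ae_eq hΛ f⟩
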